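/- **Setting.** Let $\Omega$ be a finite set, $E:\Omega\to[0,\infty)$ an energy function and $0=\beta_0\le\beta_1\le\dots\le\beta_\ell$ ($\ell\ge 1$) a schedule of inverse temperatures. Put $Z_i=\sum_{\sigma\in\Omega}e^{-\beta_iE(\sigma)}$ (so $Z_0=|\Omega|$), $\pi_i(\sigma)=e^{-\beta_iE(\sigma)}/Z_i$, $|\pi_i\rangle=\sum_\sigma\sqrt{\pi_i(\sigma)}\,|\sigma\rangle$ and $R_i=2|\pi_i\rangle\langle\pi_i|-I$. Assume that $\alpha_i=Z_{i+1}/Z_i\ge\frac12$ for $i=0,\dots,\ell-1$. The quantity to be estimated is $Z=Z_\ell$. With $y_i(\sigma)=e^{-(\beta_{i+1}-\beta_i)E(\sigma)}$ let $V_i$ be the unitary $$V_i=\sum_{\sigma\in\Omega}|\sigma\rangle\langle\sigma|\otimes\begin{pmatrix}\sqrt{y_i(\sigma)}&\sqrt{1-y_i(\sigma)}\\-\sqrt{1-y_i(\sigma)}&\sqrt{y_i(\sigma)}\end{pmatrix}.$$ **Schemes.** A scheme is one fixed finite program (with assignments, conditionals, and loops whose number of iterations is computed on entry) for a machine with a register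 with basis $\Omega$, a fixed number of qubits, and a random access memory for real numbers, with operations $+,-,\times,\div$, $x\mapsto\cos(\pi x)$, rational constants and comparison. The quantum instructions, each counted as one step like every classical instruction, are: Hadamard, phase $\mathrm{diag}(1,e^{i\pi x})$ with $x$ computed classically, and Toffoli gates on the qubits; measurement of a qubit; replacement of the content of the register by a perfectly prepared copy of $|\pi_i\rangle$; controlled $R_i$; and $V_i$, $V_i^\dagger$ on the register and a qubit. The program knows $\Omega,E,\beta_0,\dots,\beta_\ell$ only through these instructions and through its input, which consists of $\ell$, the precision $\epsilon$, and $|\Omega|$. The qubits start in $|0\rangle$ and the register in an arbitrary state. **Theorem.** There are a scheme $\mathcal A$ and constants $C,d$ such that, for all data $\Omega,E,\ell,\beta$ as above, all $\epsilon\in(0,1]$ and all initial states of the register, the output $Q$ of $\mathcal A$ satisfies $$\Pr\big[(1-\epsilon)Z\le Q\le(1+\epsilon)Z\big]\ge\tfrac34,$$ and on every branch of the computation $\mathcal A$ uses, for each $i=0,\dots,\ell-1$, at most $C\log(\ell+1)$ perfectly prepared quantum samples $|\pi_i\rangle$ and at most $C\,\frac{\ell}{\epsilon}\log(\ell+1)$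 applications of controlled $R_i$, and takes at most $C(\ell/\epsilon)^d$ steps in total. That is, $\mathcal A$ is a fully polynomial quantum approximation scheme for $Z$ that uses $O(\log\ell)$ copies of $|\pi_i\rangle$ and $O(\frac{\ell}{\epsilon}\log\ell)$ controlled reflections for each $i$. -/

import Mathlib

namespace QScheme

noncomputable section

/-- A classical system with state space `Ω`, an energy function, and a cooling schedule of
`len + 1` inverse temperatures `β 0, …, β len` (later values of `β` are never used). -/
structure GibbsSystem (Ω : Type*) where
  energy : Ω → ℝ
  len : ℕ
  β : ℕ → ℝ

namespace GibbsSystem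

variable {Ω : Type*} [Fintype Ω] (G : GibbsSystem Ω)

/-- The Gibbs partition function `Z_i` at inverse temperature `β i`. -/
def Z (i : ℕ) : ℝ := ∑ σ, Real.exp (-(G.β i * G.energy σ))

/-- The Boltzmann distribution `π_i`. -/
def gibbs (i : ℕ) (σ : Ω) : ℝ := Real.exp (-(G.β i * G.energy σ)) / G.Z i

/-- The ratio `α_i = Z_{i+1} / Z_i`. -/
def ratio (i : ℕ) : ℝ := G.Z (i + 1) / G.Z i

/-- The weight `y_i(σ) = exp (-(β_{i+1} - β_i) E(σ))`. -/
def weight (i : ℕ) (σ : Ω) : ℝ := Real.exp (-((G.β (i + 1) - G.β i) * G.energy σ))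

/-- The amplitudes of the quantum sample `|π_i⟩ = ∑_σ √π_i(σ) |σ⟩`. -/
def sampleAmp (i : ℕ) (σ : Ω) : ℂ := ((Real.sqrt (G.gibbs i σ) : ℝ) : ℂ)

end GibbsSystem

/-- Pure (unnormalised) states of one register with basis `Ω` and `m` qubits. -/
abbrev QState (Ω : Type*) (m : ℕ) := Ω → (Fin m → Bool) → ℂ

namespace QState

variable {Ω : Type*} {m : ℕ}

/-- Squared norm. -/
def normSq [Fintype Ω] (ψ : QState Ω m) : ℝ := ∑ σ, ∑ b, ‖ψ σ b‖ ^ 2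

/-- The register in state `φ`, all qubits in state `|0⟩`. -/
def init (φ : Ω → ℂ) : QState Ω m := fun σ b => if b = (fun _ => false) then φ σ else 0

/-- Hadamard gate on qubit `q`. -/
def had (q : Fin m) (ψ : QState Ω m) : QState Ω m := fun σ b =>
  (ψ σ (Function.update b q false) +
    (if b q then -1 else 1) * ψ σ (Function.update b q true)) / ((Real.sqrt 2 : ℝ) : ℂ)

/-- Phase gate `diag (1, exp (iπx))` on qubit `q`. -/
def phase (q : Fin m) (x : ℝ) (ψ : QState Ω m) : QState Ω m := fun σ b =>
  if b q then Complex.exp (((Real.pi * x : ℝ) : ℂ) * Complex.I) * ψ σ b else ψ σ b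

/-- Toffoli gate with controls `a`, `c` and target `t` (a controlled NOT if `a = c`);
it does nothing if the target is one of the controls. -/
def toffoli (a c t : Fin m) (ψ : QState Ω m) : QState Ω m := fun σ b =>
  if t = a ∨ t = c then ψ σ b
  else ψ σ (if b a && b c then Function.update b t (!(b t)) else b)

/-- The unnormalised state after qubit `q` was measured with outcome `v`. -/
def project (q : Fin m) (v : Bool) (ψ : QState Ω m) : QState Ω m := fun σ b =>
  if b q = v then ψ σ b else 0

/-- The register was found in basis state `τ`, is discarded, and is replaced by `|π_i⟩`. -/
def replace [Fintype Ω] (G : GibbsSystem Ω) (i : ℕ) (τ : Ω) (ψ : QState Ω m) : QState Ω m :=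
  fun σ b => G.sampleAmp i σ * ψ τ b

/-- `R_i = 2|π_i⟩⟨π_i| - I` on the register, controlled by qubit `q`. -/
def ctrlRefl [Fintype Ω] (G : GibbsSystem Ω) (i : ℕ) (q : Fin m) (ψ : QState Ω m) :
    QState Ω m := fun σ b =>
  if b q then 2 * G.sampleAmp i σ * (∑ τ, star (G.sampleAmp i τ) * ψ τ b) - ψ σ b else ψ σ b

/-- The unitary `V_i = ∑_σ |σ⟩⟨σ| ⊗ !![√y_i(σ), √(1-y_i(σ)); -√(1-y_i(σ)), √y_i(σ)]` on the
register and qubit `q`. -/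
def rot (G : GibbsSystem Ω) (i : ℕ) (q : Fin m) (ψ : QState Ω m) : QState Ω m := fun σ b =>
  if b q then
    -((Real.sqrt (1 - G.weight i σ) : ℝ) : ℂ) * ψ σ (Function.update b q false)
      + ((Real.sqrt (G.weight i σ) : ℝ) : ℂ) * ψ σ (Function.update b q true)
  else
    ((Real.sqrt (G.weight i σ) : ℝ) : ℂ) * ψ σ (Function.update b q false)
      + ((Real.sqrt (1 - G.weight i σ) : ℝ) : ℂ) * ψ σ (Function.update b q true)

/-- The adjoint of `V_i`. -/
def rotInv (G : GibbsSystem Ω) (i : ℕ) (q : Fin m) (ψ : QState Ω m) : QState Ω m := fun σ b =>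
  if b q then
    ((Real.sqrt (1 - G.weight i σ) : ℝ) : ℂ) * ψ σ (Function.update b q false)
      + ((Real.sqrt (G.weight i σ) : ℝ) : ℂ) * ψ σ (Function.update b q true)
  else
    ((Real.sqrt (G.weight i σ) : ℝ) : ℂ) * ψ σ (Function.update b q false)
      - ((Real.sqrt (1 - G.weight i σ) : ℝ) : ℂ) * ψ σ (Function.update b q true)

end QState

/-- Arithmetic expressions over a random access memory of real numbers. A real used as an
address, as an index or as a number of iterations is rounded down to a natural number. -/
inductive Expr where
  | const (c : ℚ)
  | read (addr : Expr)
  | add (e f : Expr)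
  | sub (e f : Expr)
  | mul (e f : Expr)
  | div (e f : Expr)
  | cosPi (e : Expr)

/-- The value of an expression; `cosPi` is `x ↦ cos (πx)`. -/
def Expr.eval (M : ℕ → ℝ) : Expr → ℝ
  | .const c => (c : ℝ)
  | .read a => M ⌊a.eval M⌋₊
  | .add e f => e.eval M + f.eval M
  | .sub e f => e.eval M - f.eval M
  | .mul e f => e.eval M * f.eval M
  | .div e f => e.eval M / f.eval M
  | .cosPi e => Real.cos (Real.pi * e.eval M)

/-- Programs with classical control for a machine with `m` qubits and one `Ω`-register. A program
is a finite text that mentions neither the state space nor the energies nor the temperatures. -/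
inductive Program (m : ℕ) where
  | skip
  | assign (addr val : Expr)
  | seq (c d : Program m)
  | ite (test : Expr) (c d : Program m)
  | loop (count : Expr) (c : Program m)
  | had (q : Fin m)
  | phase (q : Fin m) (angle : Expr)
  | toffoli (a c t : Fin m)
  | measure (q : Fin m) (addr : Expr)
  | sample (index : Expr)
  | ctrlRefl (index : Expr) (q : Fin m)
  | rot (index : Expr) (q : Fin m)
  | rotInv (index : Expr) (q : Fin m)

/-- A configuration on one branch of a computation: the unnormalised quantum state, whose squared
norm is the probability of the branch; the classical memory; and counters for the copies of
`|π_i⟩` used, for the applications of controlled `R_i`, and for all steps. -/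
structure Config (Ω : Type*) (m : ℕ) where
  state : QState Ω m
  mem : ℕ → ℝ
  samples : ℕ → ℕ
  refls : ℕ → ℕ
  steps : ℕ

namespace Config

variable {Ω : Type*} {m : ℕ}

/-- Count one step. -/
def tick (s : Config Ω m) : Config Ω m := { s with steps := s.steps + 1 }

/-- Apply an operation to the quantum state, as one step. -/
def act (f : QState Ω m → QState Ω m) (s : Config Ω m) : Config Ω m :=
  { s.tick with state := f s.state }

/-- Write `x` at address `a`. -/
def write (a : ℕ) (x : ℝ) (s : Config Ω m) : Config Ω m :=
  { s with mem := Function.update s.mem a x }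

def countSample (i : ℕ) (s : Config Ω m) : Config Ω m :=
  { s with samples := Function.update s.samples i (s.samples i + 1) }

def countRefl (i : ℕ) (s : Config Ω m) : Config Ω m :=
  { s with refls := Function.update s.refls i (s.refls i + 1) }

/-- The initial configuration for `G` and precision `ε`: the qubits are `|0⟩`, the register holds
`φ`, the memory holds the number of stages, the precision and the size of the state space. -/
def start [Fintype Ω] (m : ℕ) (G : GibbsSystem Ω) (ε : ℝ) (φ : Ω → ℂ) : Config Ω m where
  state := QState.init φ
  mem := fun a => if a = 0 then (G.len : ℝ) else if a = 1 then ε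
    else if a = 2 then (Fintype.card Ω : ℝ) else 0
  samples := fun _ => 0
  refls := fun _ => 0
  steps := 0

end Config

/-- All branches of the execution of a program. The instructions that take an index `i` do
nothing unless `i < G.len`. -/
def Program.run {Ω : Type*} [Fintype Ω] {m : ℕ} (G : GibbsSystem Ω) :
    Program m → Config Ω m → Multiset (Config Ω m)
  | .skip, s => {s.tick}
  | .assign a e, s => {s.tick.write ⌊a.eval s.mem⌋₊ (e.eval s.mem)}
  | .seq c d, s => (c.run G s).bind fun t => d.run G t
  | .ite e c d, s => if 0 < e.eval s.mem then c.run G s.tick else d.run G s.tick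
  | .loop e c, s => (fun S => S.bind fun t => c.run G t.tick)^[⌊e.eval s.mem⌋₊] {s.tick}
  | .had q, s => {s.act (QState.had q)}
  | .phase q e, s => {s.act (QState.phase q (e.eval s.mem))}
  | .toffoli a c t, s => {s.act (QState.toffoli a c t)}
  | .measure q a, s =>
      {(s.act (QState.project q false)).write ⌊a.eval s.mem⌋₊ 0,
       (s.act (QState.project q true)).write ⌊a.eval s.mem⌋₊ 1}
  | .sample e, s =>
      if ⌊e.eval s.mem⌋₊ < G.len then
        (Finset.univ : Finset Ω).val.map fun τ =>
          (s.act (QState.replace G ⌊e.eval s.mem⌋₊ τ)).countSample ⌊e.eval s.mem⌋₊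
      else {s.tick}
  | .ctrlRefl e q, s =>
      if ⌊e.eval s.mem⌋₊ < G.len then
        {(s.act (QState.ctrlRefl G ⌊e.eval s.mem⌋₊ q)).countRefl ⌊e.eval s.mem⌋₊}
      else {s.tick}
  | .rot e q, s =>
      if ⌊e.eval s.mem⌋₊ < G.len then {s.act (QState.rot G ⌊e.eval s.mem⌋₊ q)} else {s.tick}
  | .rotInv e q, s =>
      if ⌊e.eval s.mem⌋₊ < G.len then {s.act (QState.rotInv G ⌊e.eval s.mem⌋₊ q)} else {s.tick}

open Classical in
/-- The probability that the final configuration satisfies `p`. -/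
def branchProb {Ω : Type*} [Fintype Ω] {m : ℕ} (S : Multiset (Config Ω m))
    (p : Config Ω m → Prop) : ℝ :=
  (S.map fun s => if p s then s.state.normSq else 0).sum

/-- The output of a computation is the final content of memory cell `0`. -/
def Config.output {Ω : Type*} {m : ℕ} (s : Config Ω m) : ℝ := s.mem 0

end

end QScheme

namespace QScheme

noncomputable section

set_option linter.unusedSectionVars false

variable {Ω : Type*} [Fintype Ω] {m : ℕ}

/-! Write `α_i = cos² θ` with `θ = πτ/4`; since `α_i ≥ 1/2`, the unknown `τ` lies in `[0, 1]`.
Applying `V_i` to `|π_i⟩ ⊗ |1⟩` gives `cos θ · g ⊗ |1⟩ + sin θ · u ⊗ |0⟩` with unit vectors `g`, `u`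
(`IsFrame`). One amplification round, built from `V_i`, its adjoint, one controlled reflection and
sign flips, rotates the real plane of `g ⊗ |1⟩` and `u ⊗ |0⟩` by `2θ` (`amplify_plane`). Measuring
the flag always leaves a multiple of one of these two axis vectors. Hence after `k` rounds a
measurement agrees with the previous one with probability `(1 + cos (πkτ)) / 2`, whatever the past.
These agreements behave as independent signs of mean `cos (πkτ)`, and one copy of `|π_i⟩` serves the
whole stage.

The value of `τ` is located by trisection. For an interval `[a, a + L]` a multiplier `k` of order `1
/ L` is chosen so that `x ↦ cos (πkx)` is monotone there (`exists_unfolded`, `search_spec`). The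
cosines at the two trisection points then differ by at least a constant (`Unfolded.cos_trisect`), so
a constant number of signs tells the two outer thirds apart with constant confidence
(`statistic_mgf_le`). If `τ` is in the middle third, either answer is harmless.

The cost is kept at `O((ℓ/ε) log ℓ)` by an uneven division of the failure probability. Round `r` of
`R` uses about `log ℓ · (6/5)^(R-r)` signs, each with at most `(3/2)^r` reflections. The products
form a geometric sum of order `log ℓ · (3/2)^R`, and `(3/2)^R` is of order `ℓ/ε`. The failure
probabilities are at most `(1/2)^(R-r) / (4ℓ)`, which sum to at most `1 / (4ℓ)` per stage and `1/4`
in all. Final intervals of length at most `ε / (4ℓ)` give every ratio up to relative error `ε /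
(2ℓ)` (`Approximates.mul_estimate`), hence the telescoping product, started at `Z_0 = |Ω|`, up to
`ε`.

The bookkeeping is done by `Meets`, which keeps apart what holds on every branch (cost, shape of the
state) and what may fail (correctness of the interval and of the product). -/

/-- The probability of a branch. -/
abbrev Config.prob (s : Config Ω m) : ℝ := s.state.normSq

theorem QState.normSq_nonneg (ψ : QState Ω m) : 0 ≤ ψ.normSq :=
  Finset.sum_nonneg fun _ _ => Finset.sum_nonneg fun _ _ => by positivity

/-! ### Sums over branches and a union-bound calculus for programs. -/

/-- Summation of a functional over the branches of a computation. -/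
def branchSum (S : Multiset (Config Ω m)) (f : Config Ω m → ℝ) : ℝ := (S.map f).sum

theorem branchSum_singleton (s : Config Ω m) (f : Config Ω m → ℝ) :
    branchSum {s} f = f s := by
  simp [branchSum]

theorem branchSum_pair (s t : Config Ω m) (f : Config Ω m → ℝ) :
    branchSum {s, t} f = f s + f t := by
  simp [branchSum]

theorem branchSum_mono {S : Multiset (Config Ω m)} {f g : Config Ω m → ℝ}
    (h : ∀ s ∈ S, f s ≤ g s) : branchSum S f ≤ branchSum S g :=
  Multiset.sum_map_le_sum_map f g h

theorem branchSum_congr {S : Multiset (Config Ω m)} {f g : Config Ω m → ℝ}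
    (h : ∀ s ∈ S, f s = g s) : branchSum S f = branchSum S g := by
  unfold branchSum
  rw [Multiset.map_congr rfl h]

theorem branchSum_add (S : Multiset (Config Ω m)) (f g : Config Ω m → ℝ) :
    branchSum S (fun s => f s + g s) = branchSum S f + branchSum S g :=
  Multiset.sum_map_add

theorem branchSum_const_mul (S : Multiset (Config Ω m)) (c : ℝ) (f : Config Ω m → ℝ) :
    branchSum S (fun s => c * f s) = c * branchSum S f :=
  Multiset.sum_map_mul_left

theorem branchSum_bind (S : Multiset (Config Ω m)) (K : Config Ω m → Multiset (Config Ω m))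
    (f : Config Ω m → ℝ) : branchSum (S.bind K) f = branchSum S fun s => branchSum (K s) f := by
  induction S using Multiset.induction_on with
  | empty => simp [branchSum]
  | cons a S ih =>
    simp only [branchSum, Multiset.cons_bind, Multiset.map_add, Multiset.sum_add,
      Multiset.map_cons, Multiset.sum_cons] at ih ⊢
    rw [ih]

theorem branchProb_eq_branchSum (S : Multiset (Config Ω m)) (p : Config Ω m → Prop)
    [DecidablePred p] : branchProb S p = branchSum S fun s => if p s then s.prob else 0 := by
  unfold branchProb branchSum
  congr 2
  funext s
  congr

theorem branchProb_not (S : Multiset (Config Ω m)) (p : Config Ω m → Prop) :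
    branchProb S p = branchSum S Config.prob - branchProb S fun s => ¬ p s := by
  classical
  rw [branchProb_eq_branchSum, branchProb_eq_branchSum, eq_sub_iff_add_eq, ← branchSum_add]
  refine branchSum_congr fun s _ => ?_
  by_cases h : p s <;> simp [h]

theorem branchProb_mono {S : Multiset (Config Ω m)} {p q : Config Ω m → Prop}
    (h : ∀ s ∈ S, p s → q s) : branchProb S p ≤ branchProb S q := by
  classical
  rw [branchProb_eq_branchSum, branchProb_eq_branchSum]
  refine branchSum_mono fun s hs => ?_
  by_cases hp : p s
  · simp [hp, h s hs hp]
  · simp only [hp, if_false]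
    split_ifs
    · exact s.state.normSq_nonneg
    · exact le_rfl

theorem branchProb_le_mass (S : Multiset (Config Ω m)) (p : Config Ω m → Prop) :
    branchProb S p ≤ branchSum S Config.prob := by
  classical
  rw [branchProb_eq_branchSum]
  refine branchSum_mono fun s _ => ?_
  split_ifs
  · exact le_rfl
  · exact s.state.normSq_nonneg

theorem branchProb_bind (S : Multiset (Config Ω m)) (K : Config Ω m → Multiset (Config Ω m))
    (p : Config Ω m → Prop) :
    branchProb (S.bind K) p = branchSum S fun s => branchProb (K s) p := by
  classical
  simp only [branchProb_eq_branchSum, branchSum_bind]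

/-- The branches `S` have total probability `w`, all satisfy `I`, and satisfy `Q` except with
probability `δ * w`. -/
structure Meets (S : Multiset (Config Ω m)) (w : ℝ) (I Q : Config Ω m → Prop) (δ : ℝ) :
    Prop where
  sure : ∀ t ∈ S, I t
  mass : branchSum S Config.prob = w
  fail : branchProb S (fun t => ¬ Q t) ≤ δ * w

namespace Meets

theorem mono {S : Multiset (Config Ω m)} {w δ δ' : ℝ} {I I' Q Q' : Config Ω m → Prop}
    (h : Meets S w I Q δ) (hI : ∀ t, I t → I' t) (hQ : ∀ t, I t → Q t → Q' t) (hδ : δ ≤ δ') :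
    Meets S w I' Q' δ' where
  sure t ht := hI t (h.sure t ht)
  mass := h.mass
  fail := by
    have hw : 0 ≤ w := by
      rw [← h.mass]
      exact Multiset.sum_nonneg (by simpa using fun s _ => s.state.normSq_nonneg)
    refine (branchProb_mono fun t ht hn hq => hn (hQ t (h.sure t ht) hq)).trans
      (h.fail.trans ?_)
    gcongr

theorem singleton {s : Config Ω m} {w : ℝ} {I Q : Config Ω m → Prop} (hw : s.prob = w)
    (hI : I s) (hQ : Q s) : Meets {s} w I Q 0 where
  sure t ht := by
    rw [Multiset.mem_singleton] at ht
    exact ht ▸ hI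
  mass := by rw [branchSum_singleton, hw]
  fail := by
    classical
    rw [branchProb_eq_branchSum, branchSum_singleton]
    simp [hQ]

/-- The union bound for sequential composition. A branch violating `Q₁` is charged its whole
probability, which the second part preserves; a branch satisfying `Q₁` loses at most the fraction
`δ₂`. The second part must keep its sure property and its mass even after a failure of the first. -/
theorem bind {S : Multiset (Config Ω m)} {K : Config Ω m → Multiset (Config Ω m)}
    {w δ₁ δ₂ : ℝ} {I₁ Q₁ I₂ Q₂ : Config Ω m → Prop} (h₁ : Meets S w I₁ Q₁ δ₁)
    (hδ₂ : 0 ≤ δ₂)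
    (h₂ : ∀ t, I₁ t → Meets (K t) t.prob I₂ (fun u => Q₁ t → Q₂ u) δ₂) :
    Meets (S.bind K) w I₂ Q₂ (δ₁ + δ₂) where
  sure u hu := by
    obtain ⟨t, ht, hu⟩ := Multiset.mem_bind.1 hu
    exact (h₂ t (h₁.sure t ht)).sure u hu
  mass := by
    rw [branchSum_bind, ← h₁.mass]
    exact branchSum_congr fun t ht => (h₂ t (h₁.sure t ht)).mass
  fail := by
    classical
    rw [branchProb_bind]
    have key : branchSum S (fun s => branchProb (K s) fun t => ¬ Q₂ t) ≤
        branchSum S fun s => (if ¬ Q₁ s then s.prob else 0) + δ₂ * s.prob := by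
      refine branchSum_mono fun t ht => ?_
      have h := h₂ t (h₁.sure t ht)
      by_cases hq : Q₁ t
      · simp only [hq, not_true_eq_false, if_false, zero_add]
        simpa [hq] using h.fail
      · simp only [hq, not_false_eq_true, if_true]
        refine (branchProb_le_mass _ _).trans ?_
        rw [h.mass]
        have := mul_nonneg hδ₂ t.state.normSq_nonneg
        linarith
    refine key.trans ?_
    rw [branchSum_add, branchSum_const_mul, h₁.mass, ← branchProb_eq_branchSum, add_mul]
    linarith [h₁.fail]

theorem iterate {c : Config Ω m → Multiset (Config Ω m)} {s : Config Ω m}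
    {I Q : ℕ → Config Ω m → Prop} {δ : ℕ → ℝ} (hδ : ∀ j, 0 ≤ δ j) (h0 : I 0 s) (hq0 : Q 0 s)
    (n : ℕ)
    (h : ∀ j < n, ∀ t, I j t →
      Meets (c t) t.prob (I (j + 1)) (fun u => Q j t → Q (j + 1) u) (δ j)) :
    Meets ((fun S : Multiset (Config Ω m) => S.bind c)^[n] {s}) s.prob (I n) (Q n)
      (∑ j ∈ Finset.range n, δ j) := by
  induction n with
  | zero => simpa using singleton (I := I 0) (Q := Q 0) (s := s) rfl h0 hq0
  | succ n ih =>
    rw [Function.iterate_succ_apply', Finset.sum_range_succ]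
    exact (ih fun j hj => h j (by omega)).bind (hδ n) (h n (by omega))

end Meets

theorem Meets.loop {G : GibbsSystem Ω} {e : Expr} {c : Program m} {s : Config Ω m}
    {I Q : ℕ → Config Ω m → Prop} {δ : ℕ → ℝ} (hδ : ∀ j, 0 ≤ δ j) {n : ℕ}
    (hn : ⌊e.eval s.mem⌋₊ = n) (h0 : I 0 s.tick) (hq0 : Q 0 s.tick)
    (h : ∀ j < n, ∀ t, I j t →
      Meets (c.run G t.tick) t.prob (I (j + 1)) (fun u => Q j t → Q (j + 1) u) (δ j)) :
    Meets ((Program.loop e c).run G s) s.prob (I n) (Q n) (∑ j ∈ Finset.range n, δ j) := by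
  rw [Program.run, hn]
  exact Meets.iterate (c := fun t => c.run G t.tick) (s := s.tick) hδ h0 hq0 n h

/-- A loop whose body never branches. -/
theorem Program.run_loop_eq_singleton {G : GibbsSystem Ω} {e : Expr} {c : Program m}
    {s : Config Ω m} {I : ℕ → Config Ω m → Prop} {n : ℕ} (hn : ⌊e.eval s.mem⌋₊ = n)
    (h0 : I 0 s.tick)
    (h : ∀ j < n, ∀ t, I j t → ∃ u, c.run G t.tick = {u} ∧ I (j + 1) u) :
    ∃ u, (Program.loop e c).run G s = {u} ∧ I n u := by
  rw [Program.run, hn]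
  clear hn
  induction n with
  | zero => exact ⟨s.tick, rfl, h0⟩
  | succ n ih =>
    obtain ⟨t, ht, hI⟩ := ih fun j hj => h j (by omega)
    obtain ⟨u, hu, hIu⟩ := h n (by omega) t hI
    exact ⟨u, by rw [Function.iterate_succ_apply', ht, Multiset.singleton_bind, hu], hIu⟩

/-- If one iteration multiplies the total of `f` by at most `ρ`, then `n` iterations multiply it
by at most `ρ ^ n`. -/
theorem branchSum_iterate_le {c : Config Ω m → Multiset (Config Ω m)} {s : Config Ω m}
    {I : ℕ → Config Ω m → Prop} {f : Config Ω m → ℝ} {ρ : ℝ} (hρ : 0 ≤ ρ) (h0 : I 0 s) (n : ℕ)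
    (hI : ∀ j < n, ∀ t, I j t → ∀ u ∈ c t, I (j + 1) u)
    (h : ∀ j < n, ∀ t, I j t → branchSum (c t) f ≤ ρ * f t) :
    (∀ t ∈ (fun S : Multiset (Config Ω m) => S.bind c)^[n] {s}, I n t) ∧
    branchSum ((fun S : Multiset (Config Ω m) => S.bind c)^[n] {s}) f ≤ ρ ^ n * f s := by
  induction n with
  | zero => simpa [branchSum_singleton] using h0
  | succ n ih =>
    obtain ⟨h1, h2⟩ := ih (fun j hj => hI j (by omega)) (fun j hj => h j (by omega))
    rw [Function.iterate_succ_apply']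
    constructor
    · intro u hu
      obtain ⟨t, ht, hu⟩ := Multiset.mem_bind.1 hu
      exact hI n (by omega) t (h1 t ht) u hu
    · rw [branchSum_bind]
      refine (branchSum_mono fun t ht => h n (by omega) t (h1 t ht)).trans ?_
      rw [branchSum_const_mul, pow_succ]
      nlinarith [mul_le_mul_of_nonneg_left h2 hρ]

/-- Markov's inequality. -/
theorem branchProb_le_branchSum {S : Multiset (Config Ω m)} {p : Config Ω m → Prop}
    {f : Config Ω m → ℝ} (hf : ∀ s, 0 ≤ f s) (h : ∀ s ∈ S, p s → s.prob ≤ f s) :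
    branchProb S p ≤ branchSum S f := by
  classical
  rw [branchProb_eq_branchSum]
  refine branchSum_mono fun s hs => ?_
  split_ifs with hp
  · exact h s hs hp
  · exact hf s

/-! ### Abbreviations for programs. -/

/-- Sequential execution of a list of programs. -/
def Program.block : List (Program m) → Program m
  | [] => .skip
  | p :: l => .seq p (block l)

theorem Program.run_block_cons (G : GibbsSystem Ω) (p : Program m) (l : List (Program m))
    (s : Config Ω m) :
    (Program.block (p :: l)).run G s = (p.run G s).bind fun t => (Program.block l).run G t := rfl

theorem Program.run_block_nil (G : GibbsSystem Ω) (s : Config Ω m) :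
    (Program.block []).run G s = {s.tick} := rfl

/-- The content of memory cell `n`. -/
def Expr.cell (n : ℕ) : Expr := .read (.const n)

@[simp] theorem Expr.eval_cell (M : ℕ → ℝ) (n : ℕ) : (Expr.cell n).eval M = M n := by
  simp [Expr.cell, Expr.eval]

/-- Assignment to memory cell `n`. -/
def Program.put (n : ℕ) (e : Expr) : Program m := .assign (.const n) e

@[simp] theorem Program.run_put (G : GibbsSystem Ω) (n : ℕ) (e : Expr) (s : Config Ω m) :
    (Program.put n e).run G s = {s.tick.write n (e.eval s.mem)} := by
  simp [Program.put, Program.run, Expr.eval]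

/-- Measurement of a qubit with the outcome written to memory cell `n`. -/
def Program.observe (q : Fin m) (n : ℕ) : Program m := .measure q (.const n)

@[simp] theorem Program.run_observe (G : GibbsSystem Ω) (q : Fin m) (n : ℕ) (s : Config Ω m) :
    (Program.observe q n).run G s = {(s.act (QState.project q false)).write n 0,
      (s.act (QState.project q true)).write n 1} := by
  simp [Program.observe, Program.run, Expr.eval]

/-! ### Gibbs weights and the frame of the amplification plane. -/

namespace GibbsSystem

variable (G : GibbsSystem Ω)

theorem Z_pos [Nonempty Ω] (i : ℕ) : 0 < G.Z i :=
  Finset.sum_pos (fun _ _ => Real.exp_pos _) Finset.univ_nonempty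

theorem gibbs_nonneg (i : ℕ) (σ : Ω) : 0 ≤ G.gibbs i σ :=
  div_nonneg (Real.exp_pos _).le (Finset.sum_nonneg fun _ _ => (Real.exp_pos _).le)

theorem sum_gibbs [Nonempty Ω] (i : ℕ) : ∑ σ, G.gibbs i σ = 1 := by
  simp only [gibbs, ← Finset.sum_div]
  exact div_self (G.Z_pos i).ne'

theorem sum_gibbs_mul_weight (i : ℕ) : ∑ σ, G.gibbs i σ * G.weight i σ = G.ratio i := by
  unfold ratio
  conv_rhs => rw [Z, Finset.sum_div]
  refine Finset.sum_congr rfl fun σ _ => ?_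
  rw [gibbs, weight, div_mul_eq_mul_div, ← Real.exp_add]
  ring_nf

theorem weight_pos (i : ℕ) (σ : Ω) : 0 < G.weight i σ := Real.exp_pos _

theorem weight_le_one {i : ℕ} (hβ : G.β i ≤ G.β (i + 1)) {σ : Ω} (hE : 0 ≤ G.energy σ) :
    G.weight i σ ≤ 1 := by
  rw [weight, Real.exp_le_one_iff]
  nlinarith [mul_nonneg (sub_nonneg.2 hβ) hE]

theorem ratio_le_one [Nonempty Ω] {i : ℕ} (hβ : G.β i ≤ G.β (i + 1))
    (hE : ∀ σ, 0 ≤ G.energy σ) : G.ratio i ≤ 1 := by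
  rw [← sum_gibbs_mul_weight, ← G.sum_gibbs i]
  exact Finset.sum_le_sum fun σ _ =>
    mul_le_of_le_one_right (G.gibbs_nonneg i σ) (G.weight_le_one hβ (hE σ))

/-- The orthonormal pair `g`, `u` that spans, with flag qubit `1` and `0`, the plane of
amplitude amplification at stage `i`. -/
structure IsFrame (i : ℕ) (θ : ℝ) (g u : Ω → ℝ) : Prop where
  sum_sq_good : ∑ σ, g σ ^ 2 = 1
  sum_sq_bad : ∑ σ, u σ ^ 2 = 1
  good : ∀ σ, √(G.gibbs i σ) * √(G.weight i σ) = Real.cos θ * g σ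
  bad : ∀ σ, √(G.gibbs i σ) * √(1 - G.weight i σ) = Real.sin θ * u σ

theorem exists_isFrame [Nonempty Ω] {i : ℕ} (hβ : G.β i ≤ G.β (i + 1))
    (hE : ∀ σ, 0 ≤ G.energy σ) {θ : ℝ} (hcos : Real.cos θ ^ 2 = G.ratio i)
    (hα : 0 < G.ratio i) : ∃ g u, G.IsFrame i θ g u := by
  have hc : Real.cos θ ≠ 0 := by
    intro h
    rw [h] at hcos
    norm_num at hcos
    exact hα.ne hcos
  have hsq1 : ∀ σ, (√(G.gibbs i σ) * √(G.weight i σ)) ^ 2 = G.gibbs i σ * G.weight i σ := by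
    intro σ
    rw [mul_pow, Real.sq_sqrt (G.gibbs_nonneg i σ), Real.sq_sqrt (G.weight_pos i σ).le]
  have hsq2 : ∀ σ, (√(G.gibbs i σ) * √(1 - G.weight i σ)) ^ 2
      = G.gibbs i σ * (1 - G.weight i σ) := by
    intro σ
    rw [mul_pow, Real.sq_sqrt (G.gibbs_nonneg i σ),
      Real.sq_sqrt (sub_nonneg.2 (G.weight_le_one hβ (hE σ)))]
  have hsum2 : ∑ σ, G.gibbs i σ * (1 - G.weight i σ) = Real.sin θ ^ 2 := by
    simp only [mul_sub, mul_one, Finset.sum_sub_distrib, sum_gibbs, sum_gibbs_mul_weight]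
    rw [Real.sin_sq, hcos]
  refine ⟨fun σ => √(G.gibbs i σ) * √(G.weight i σ) / Real.cos θ,
    -- If `sin θ = 0` the bad component vanishes and any unit vector may serve as `u`.
    if Real.sin θ = 0 then fun σ => √(G.gibbs i σ)
      else fun σ => √(G.gibbs i σ) * √(1 - G.weight i σ) / Real.sin θ, ?_, ?_, ?_, ?_⟩
  · simp only [div_pow, hsq1, ← Finset.sum_div, sum_gibbs_mul_weight, hcos]
    exact div_self hα.ne'
  · split_ifs with hs
    · simp only [Real.sq_sqrt (G.gibbs_nonneg i _), sum_gibbs]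
    · simp only [div_pow, hsq2, ← Finset.sum_div, hsum2]
      exact div_self (pow_ne_zero 2 hs)
  · intro σ
    rw [mul_div_cancel₀ _ hc]
  · intro σ
    split_ifs with hs
    · rw [hs, zero_mul, ← sq_eq_zero_iff, hsq2]
      rw [hs, zero_pow two_ne_zero, Finset.sum_eq_zero_iff_of_nonneg] at hsum2
      · exact hsum2 σ (Finset.mem_univ σ)
      · exact fun σ _ =>
          mul_nonneg (G.gibbs_nonneg i σ) (sub_nonneg.2 (G.weight_le_one hβ (hE σ)))
    · rw [mul_div_cancel₀ _ hs]

end GibbsSystem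

/-! ### The quantum operations on product states and on the amplification plane. -/

namespace QState

theorem sum_bits (F : Bool → ℝ) : ∑ b : Fin 1 → Bool, F (b 0) = F false + F true := by
  rw [Fintype.sum_equiv (Equiv.funUnique (Fin 1) Bool) (fun b => F (b 0)) F fun _ => rfl]
  simp [add_comm]

/-- The qubit is in basis state `v` and the register in state `χ`. -/
def flagged (v : Bool) (χ : Ω → ℂ) : QState Ω 1 := fun σ b => if b 0 = v then χ σ else 0

/-- The state `x g ⊗ |1⟩ + y u ⊗ |0⟩`. -/
def plane (g u : Ω → ℝ) (x y : ℂ) : QState Ω 1 := fun σ b =>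
  if b 0 then x * (g σ : ℂ) else y * (u σ : ℂ)

theorem init_eq_flagged (φ : Ω → ℂ) : (init φ : QState Ω 1) = flagged false φ := by
  funext σ b
  unfold init flagged
  congr 1
  rw [eq_iff_iff]
  exact ⟨fun h => by rw [h], fun h => funext fun j => by rw [Subsingleton.elim j 0, h]⟩

theorem normSq_flagged (v : Bool) (χ : Ω → ℂ) : (flagged v χ).normSq = ∑ σ, ‖χ σ‖ ^ 2 := by
  unfold normSq flagged
  refine Finset.sum_congr rfl fun σ _ => ?_
  rw [sum_bits fun c => ‖if c = v then χ σ else 0‖ ^ 2]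
  cases v <;> simp

theorem normSq_plane {g u : Ω → ℝ} (hg : ∑ σ, g σ ^ 2 = 1) (hu : ∑ σ, u σ ^ 2 = 1) (x y : ℂ) :
    (plane g u x y).normSq = ‖x‖ ^ 2 + ‖y‖ ^ 2 := by
  unfold normSq plane
  have : ∀ σ, ∑ b : Fin 1 → Bool, ‖if b 0 then x * (g σ : ℂ) else y * (u σ : ℂ)‖ ^ 2 =
      ‖y‖ ^ 2 * u σ ^ 2 + ‖x‖ ^ 2 * g σ ^ 2 := by
    intro σ
    rw [sum_bits fun c => ‖if c then x * (g σ : ℂ) else y * (u σ : ℂ)‖ ^ 2]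
    simp [mul_pow]
  simp only [this, Finset.sum_add_distrib, ← Finset.mul_sum, hg, hu]
  ring

theorem exp_pi_one : Complex.exp (((Real.pi * (1 : ℝ) : ℝ) : ℂ) * Complex.I) = -1 := by
  simp

theorem phase_plane (g u : Ω → ℝ) (x y : ℂ) :
    phase 0 1 (plane g u x y) = plane g u (-x) y := by
  funext σ b
  simp only [phase, plane, exp_pi_one]
  split_ifs <;> ring

theorem project_true_plane (g u : Ω → ℝ) (x y : ℂ) :
    project 0 true (plane g u x y) = plane g u x 0 := by
  funext σ b
  cases h : b 0 <;> simp [project, plane, h]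

theorem project_false_plane (g u : Ω → ℝ) (x y : ℂ) :
    project 0 false (plane g u x y) = plane g u 0 y := by
  funext σ b
  cases h : b 0 <;> simp [project, plane, h]

theorem plane_true (g u : Ω → ℝ) (x : ℂ) :
    plane g u x 0 = flagged true fun σ => x * (g σ : ℂ) := by
  funext σ b
  cases h : b 0 <;> simp [flagged, plane, h]

theorem plane_false (g u : Ω → ℝ) (y : ℂ) :
    plane g u 0 y = flagged false fun σ => y * (u σ : ℂ) := by
  funext σ b
  cases h : b 0 <;> simp [flagged, plane, h]

/-- With the flag in a basis state, discarding the register leaves no entanglement: each discarded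
`τ` contributes only a scalar factor `χ τ`. -/
theorem replace_flagged (G : GibbsSystem Ω) (i : ℕ) (τ : Ω) (v : Bool) (χ : Ω → ℂ) :
    replace G i τ (flagged v χ) = flagged v fun σ => G.sampleAmp i σ * χ τ := by
  funext σ b
  simp [replace, flagged]

/-- Conjugating the phase flip with Hadamard gates gives a NOT gate. -/
theorem not_flagged_false (χ : Ω → ℂ) :
    had 0 (phase 0 1 (had 0 (flagged false χ))) = flagged true χ := by
  have h2 : ((√2 : ℝ) : ℂ) * ((√2 : ℝ) : ℂ) = 2 := by
    rw [← Complex.ofReal_mul, Real.mul_self_sqrt (by norm_num)]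
    norm_num
  have h0 : ((√2 : ℝ) : ℂ) ≠ 0 := by
    intro h
    rw [h] at h2
    norm_num at h2
  funext σ b
  cases h : b 0 <;> simp only [had, phase, exp_pi_one, flagged, Function.update_self, h] <;>
    simp <;> field_simp <;> linear_combination (-χ σ) * h2

variable {G : GibbsSystem Ω} {i : ℕ}

theorem rot_flagged {θ : ℝ} {g u : Ω → ℝ} (hf : G.IsFrame i θ g u) (c : ℂ) :
    rot G i 0 (flagged true fun σ => G.sampleAmp i σ * c) =
      plane g u (c * Real.cos θ) (c * Real.sin θ) := by
  funext σ b
  have h1 : (Real.cos θ : ℂ) * (g σ : ℂ) = (√(G.gibbs i σ) : ℂ) * (√(G.weight i σ) : ℂ) := by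
    exact_mod_cast (hf.good σ).symm
  have h2 : (Real.sin θ : ℂ) * (u σ : ℂ) = (√(G.gibbs i σ) : ℂ) * (√(1 - G.weight i σ) : ℂ) := by
    exact_mod_cast (hf.bad σ).symm
  cases h : b 0 <;> simp only [rot, flagged, plane, Function.update_self, h,
    GibbsSystem.sampleAmp] <;> simp [-Complex.ofReal_cos, -Complex.ofReal_sin]
  · linear_combination (-c) * h2
  · linear_combination (-c) * h1

/-- One round of amplitude amplification. -/
def amplify (G : GibbsSystem Ω) (i : ℕ) (ψ : QState Ω 1) : QState Ω 1 :=
  rot G i 0 (phase 0 1 (ctrlRefl G i 0 (rotInv G i 0 (phase 0 1 ψ))))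

/-- A product of two reflections is a rotation. The controlled `R_i` followed by the sign flip of
the flag is `I - 2|π_i, 1⟩⟨π_i, 1|`; conjugation by `V_i` turns it into the reflection in the line
orthogonal to `(cos θ, sin θ)` within the plane, and it is preceded by the reflection `x ↦ -x`. -/
theorem amplify_plane {θ : ℝ} {g u : Ω → ℝ} (hf : G.IsFrame i θ g u)
    (hw : ∀ σ, G.weight i σ ≤ 1) (x y : ℂ) :
    amplify G i (plane g u x y) =
      plane g u (x * Real.cos (2 * θ) - y * Real.sin (2 * θ))
        (x * Real.sin (2 * θ) + y * Real.cos (2 * θ)) := by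
  have h1 : ∀ σ, (Real.cos θ : ℂ) * (g σ : ℂ)
      = (√(G.gibbs i σ) : ℂ) * (√(G.weight i σ) : ℂ) := by
    intro σ
    exact_mod_cast (hf.good σ).symm
  have h2 : ∀ σ, (Real.sin θ : ℂ) * (u σ : ℂ)
      = (√(G.gibbs i σ) : ℂ) * (√(1 - G.weight i σ) : ℂ) := by
    intro σ
    exact_mod_cast (hf.bad σ).symm
  have h3 : ∀ σ, (√(G.weight i σ) : ℂ) ^ 2 + (√(1 - G.weight i σ) : ℂ) ^ 2 = 1 := by
    intro σ
    have : √(G.weight i σ) ^ 2 + √(1 - G.weight i σ) ^ 2 = 1 := by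
      rw [Real.sq_sqrt (G.weight_pos i σ).le, Real.sq_sqrt (sub_nonneg.2 (hw σ))]
      ring
    exact_mod_cast this
  have hg : ∑ σ, (g σ : ℂ) ^ 2 = 1 := by exact_mod_cast hf.sum_sq_good
  have hu : ∑ σ, (u σ : ℂ) ^ 2 = 1 := by exact_mod_cast hf.sum_sq_bad
  have hcs : (Real.cos θ : ℂ) ^ 2 + (Real.sin θ : ℂ) ^ 2 = 1 := by
    exact_mod_cast Real.cos_sq_add_sin_sq θ
  -- The inner product of the reflected state `(-x, y)` with `(cos θ, sin θ)`, computed after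
  -- pulling back by the adjoint of `V_i`.
  have hm : ∑ τ, (√(G.gibbs i τ) : ℂ) * ((√(1 - G.weight i τ) : ℂ) * (y * (u τ : ℂ))
      + (√(G.weight i τ) : ℂ) * (-x * (g τ : ℂ))) = y * Real.sin θ - x * Real.cos θ := by
    have : ∀ τ, (√(G.gibbs i τ) : ℂ) * ((√(1 - G.weight i τ) : ℂ) * (y * (u τ : ℂ))
      + (√(G.weight i τ) : ℂ) * (-x * (g τ : ℂ))) =
        (y * Real.sin θ) * (u τ : ℂ) ^ 2 - (x * Real.cos θ) * (g τ : ℂ) ^ 2 := by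
      intro τ
      linear_combination (x * g τ) * h1 τ - (y * u τ) * h2 τ
    simp only [this, Finset.sum_sub_distrib, ← Finset.mul_sum, hg, hu, mul_one]
  have hc2 : (Real.cos (2 * θ) : ℂ) = 2 * (Real.cos θ : ℂ) ^ 2 - 1 := by
    rw [Real.cos_two_mul]
    push_cast
    ring
  have hs2 : (Real.sin (2 * θ) : ℂ) = 2 * (Real.sin θ : ℂ) * (Real.cos θ : ℂ) := by
    rw [Real.sin_two_mul]
    push_cast
    ring
  rw [amplify, phase_plane]
  funext σ b
  rw [hc2, hs2]
  have hr : ∀ z, star (G.sampleAmp i z) = (√(G.gibbs i z) : ℂ) := by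
    intro z
    simp [GibbsSystem.sampleAmp]
  cases h : b 0 <;> simp only [rot, phase, exp_pi_one, ctrlRefl, rotInv, plane,
    Function.update_self, h, hr] <;> simp only [if_true, Bool.false_eq_true, if_false]
  all_goals rw [hm, GibbsSystem.sampleAmp]
  · linear_combination (y * u σ) * h3 σ + 2 * (y * Real.sin θ - x * Real.cos θ) * h2 σ
      - 2 * y * u σ * hcs
  · linear_combination (-x * g σ) * h3 σ + 2 * (y * Real.sin θ - x * Real.cos θ) * h1 σ

theorem iterate_amplify_plane {θ : ℝ} {g u : Ω → ℝ} (hf : G.IsFrame i θ g u)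
    (hw : ∀ σ, G.weight i σ ≤ 1) (x y : ℂ) (k : ℕ) :
    (amplify G i)^[k] (plane g u x y) =
      plane g u (x * Real.cos (k * (2 * θ)) - y * Real.sin (k * (2 * θ)))
        (x * Real.sin (k * (2 * θ)) + y * Real.cos (k * (2 * θ))) := by
  induction k with
  | zero => simp
  | succ k ih =>
    rw [Function.iterate_succ_apply', ih, amplify_plane hf hw]
    have h : ((k + 1 : ℕ) : ℝ) * (2 * θ) = k * (2 * θ) + 2 * θ := by
      push_cast
      ring
    rw [h, Real.cos_add, Real.sin_add]
    congr 1 <;> push_cast <;> ring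

end QState

/-! ### Multipliers that unfold an interval. -/

/-- `cos (πz)` is monotone on `k * [a, a + L]`. -/
def Unfolded (k : ℕ) (a L : ℝ) : Prop := ∃ n : ℤ, (n : ℝ) ≤ k * a ∧ k * (a + L) ≤ n + 1

theorem cos_pi_mul_eq (z : ℝ) (n : ℤ) :
    Real.cos (Real.pi * z) = (-1) ^ n * Real.cos (Real.pi * (z - n)) := by
  rw [← Real.cos_add_int_mul_pi]
  congr 1
  ring

theorem neg_one_zpow_mul_self (n : ℤ) : ((-1 : ℝ) ^ n) * (-1) ^ n = 1 := by
  rw [← mul_zpow]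
  norm_num

theorem cos_pi_mul_sub_half (z : ℝ) :
    Real.cos (Real.pi * (z - 1 / 2)) = Real.sin (Real.pi * z) := by
  rw [← Real.cos_sub_pi_div_two]
  congr 1
  ring

theorem sin_pi_mul_eq (z : ℝ) (n : ℤ) :
    Real.sin (Real.pi * z) = (-1) ^ n * Real.sin (Real.pi * (z - n)) := by
  rw [← cos_pi_mul_sub_half, ← cos_pi_mul_sub_half, cos_pi_mul_eq _ n]
  ring_nf

/-- This makes the property testable by the machine. Below length `1` the scaled interval has at
most one integer in its interior, and `sin (πz)` changes sign exactly there; the shift by `1/2`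
expresses the sine through the available cosine. -/
theorem unfolded_iff {k : ℕ} {a L : ℝ} (hL : 0 ≤ L) (hkL : k * L < 1) :
    Unfolded k a L ↔ ¬ 0 < 0 - Real.cos (Real.pi * (k * a - 1 / 2)) *
      Real.cos (Real.pi * (k * (a + L) - 1 / 2)) := by
  have hkL0 : 0 ≤ k * L := mul_nonneg (Nat.cast_nonneg k) hL
  rw [cos_pi_mul_sub_half, cos_pi_mul_sub_half, zero_sub, neg_pos, not_lt]
  have hpi := Real.pi_pos
  constructor
  · rintro ⟨n, h1, h2⟩
    rw [sin_pi_mul_eq _ n, sin_pi_mul_eq (k * (a + L)) n, mul_mul_mul_comm,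
      neg_one_zpow_mul_self, one_mul]
    apply mul_nonneg <;> apply Real.sin_nonneg_of_nonneg_of_le_pi <;> nlinarith
  · intro h
    by_contra hn
    have h1 : (⌊k * a⌋ : ℝ) ≤ k * a := Int.floor_le _
    have h2 : k * a < ⌊k * a⌋ + 1 := Int.lt_floor_add_one _
    have h3 : (⌊k * a⌋ : ℝ) + 1 < k * (a + L) := by
      by_contra h3
      exact hn ⟨_, h1, not_lt.1 h3⟩
    rw [sin_pi_mul_eq _ (⌊k * a⌋ + 1), sin_pi_mul_eq (k * (a + L)) (⌊k * a⌋ + 1),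
      mul_mul_mul_comm, neg_one_zpow_mul_self, one_mul] at h
    push_cast at h
    have h4 : Real.sin (Real.pi * (k * a - (⌊k * a⌋ + 1))) < 0 :=
      Real.sin_neg_of_neg_of_neg_pi_lt (by nlinarith) (by nlinarith)
    have h5 : 0 < Real.sin (Real.pi * (k * (a + L) - (⌊k * a⌋ + 1))) :=
      Real.sin_pos_of_pos_of_lt_pi (by nlinarith) (by nlinarith)
    nlinarith

/-- If an integer is interior to `K * [a, a + L]`, lowering the multiplier by `q` moves the interval
by about `q * a`. Since the scaled length is at most `1/10`, any shift between `1/10` and `9/10`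
modulo `1` clears that integer without reaching the next one, and a suitable `q` of at most `3K/4`
exists. -/
theorem exists_unfolded {a L : ℝ} (ha : 0 ≤ a) (hL : 0 ≤ L) (haL : a + L ≤ 1) {K : ℕ}
    (hK : 1 ≤ K) (hKL : K * L ≤ 1 / 10) : ∃ k, 1 ≤ k ∧ k ≤ K ∧ K ≤ 4 * k ∧ Unfolded k a L := by
  by_cases hgood : Unfolded K a L
  · exact ⟨K, hK, le_rfl, by omega, hgood⟩
  have h1 : (⌊K * a⌋ : ℝ) ≤ K * a := Int.floor_le _
  have h2 : K * a < ⌊K * a⌋ + 1 := Int.lt_floor_add_one _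
  have h3 : (⌊K * a⌋ : ℝ) + 1 < K * (a + L) := by
    by_contra h3
    exact hgood ⟨_, h1, not_lt.1 h3⟩
  have hK1 : (1 : ℝ) ≤ K := by exact_mod_cast hK
  obtain ⟨n, hn⟩ : ∃ n : ℤ, n = ⌊K * a⌋ := ⟨_, rfl⟩
  rw [← hn] at h1 h2 h3
  have hn0 : 0 ≤ n := by
    rw [hn]
    exact Int.floor_nonneg.2 (by positivity)
  have hnK : n + 2 ≤ K := by
    have : ((n + 1 : ℤ) : ℝ) < ((K : ℤ) : ℝ) := by
      push_cast
      nlinarith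
    have := Int.cast_lt.1 this
    omega
  have hK2 : 2 ≤ K := by omega
  have hK2' : (2 : ℝ) ≤ K := by exact_mod_cast hK2
  have hn0' : (0 : ℝ) ≤ n := by exact_mod_cast hn0
  have hnK' : (n : ℝ) + 2 ≤ K := by exact_mod_cast hnK
  -- The least `q` with `q * x ≥ 1/10` overshoots by less than `x ≤ 1/2`; as `x` is at least `9 /
  -- (10K)`, it also satisfies `q ≤ K / 9 + 1`.
  have pick : ∀ x : ℝ, 0 ≤ x → x ≤ 1 / 2 → 9 / 10 ≤ K * x →
      ∃ q : ℕ, 1 / 10 ≤ q * x ∧ q * x ≤ 9 / 10 ∧ q ≤ K ∧ K ≤ 4 * (K - q) := by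
    intro x hx0 hx hKx
    have hxpos : 0 < x := by
      rcases hx0.eq_or_lt with h | h
      · rw [← h] at hKx
        norm_num at hKx
      · exact h
    have hq1 : 1 / (10 * x) ≤ (⌈1 / (10 * x)⌉₊ : ℝ) := Nat.le_ceil _
    have hq2 : (⌈1 / (10 * x)⌉₊ : ℝ) < 1 / (10 * x) + 1 := Nat.ceil_lt_add_one (by positivity)
    generalize ⌈1 / (10 * x)⌉₊ = q at hq1 hq2
    have hx1 : 1 / (10 * x) * x = 1 / 10 := by field_simp
    have hqK : (q : ℝ) ≤ K / 9 + 1 := by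
      have : 1 / (10 * x) ≤ K / 9 := by
        rw [div_le_div_iff₀ (by positivity) (by norm_num)]
        linarith
      linarith
    have hqK' : 4 * (q : ℝ) ≤ 3 * K ∨ K < 2 := by
      left
      rcases Nat.lt_or_ge K 3 with h | h
      · have hK3 : K = 2 := by omega
        subst hK3
        have : (q : ℝ) < 2 := by push_cast at hqK; linarith
        have : q < 2 := by exact_mod_cast this
        have : q ≤ 1 := by omega
        have : (q : ℝ) ≤ 1 := by exact_mod_cast this
        push_cast
        linarith
      · have : (3 : ℝ) ≤ K := by exact_mod_cast h
        linarith
    have hqK'' : 4 * q ≤ 3 * K := by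
      rcases hqK' with h | h
      · exact_mod_cast h
      · omega
    refine ⟨q, ?_, ?_, by omega, by omega⟩
    · nlinarith
    · nlinarith
  rcases le_total a (1 / 2) with ha2 | ha2
  · obtain ⟨q, hq1, hq2, hqK, hq4⟩ := pick a ha ha2 (by nlinarith)
    refine ⟨K - q, by omega, by omega, hq4, n, ?_, ?_⟩
    · rw [Nat.cast_sub hqK]
      nlinarith
    · rw [Nat.cast_sub hqK]
      nlinarith [mul_nonneg (Nat.cast_nonneg q : (0 : ℝ) ≤ q) hL]
  -- The mirror image: modulo `1`, lowering the multiplier by `q` shifts the right end to the right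
  -- by `q * (1 - (a + L))`.
  · obtain ⟨q, hq1, hq2, hqK, hq4⟩ := pick (1 - (a + L)) (by linarith) (by linarith) (by nlinarith)
    refine ⟨K - q, by omega, by omega, hq4, n + 1 - q, ?_, ?_⟩
    · rw [Nat.cast_sub hqK]
      push_cast
      nlinarith [mul_nonneg (Nat.cast_nonneg q : (0 : ℝ) ≤ q) hL]
    · rw [Nat.cast_sub hqK]
      push_cast
      nlinarith

/-! ### Separation of the cosines at the trisection points. -/

theorem cos_pi_antitone {x y : ℝ} (hx : 0 ≤ x) (hxy : x ≤ y) (hy : y ≤ 1) :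
    Real.cos (Real.pi * y) ≤ Real.cos (Real.pi * x) := by
  have := Real.pi_pos
  exact Real.cos_le_cos_of_nonneg_of_le_pi (by positivity) (by nlinarith) (by nlinarith)

theorem two_mul_le_sin_pi {w : ℝ} (h0 : 0 ≤ w) (h1 : w ≤ 1 / 2) :
    2 * w ≤ Real.sin (Real.pi * w) := by
  have := Real.pi_pos
  have h := Real.mul_le_sin (x := Real.pi * w) (by positivity) (by nlinarith)
  calc 2 * w = 2 / Real.pi * (Real.pi * w) := by field_simp
    _ ≤ _ := h

/-- The difference is `2 sin (π(y + d/2)) sin (πd/6)`. The midpoint has distance at least `d/2` from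
both `0` and `1`, so Jordan's inequality bounds the two sines below by `d` and `d/3`. -/
theorem cos_pi_gap {y d : ℝ} (hy : 0 ≤ y) (hd : 0 ≤ d) (hyd : y + d ≤ 1) :
    2 / 3 * d ^ 2 ≤ Real.cos (Real.pi * (y + d / 3)) - Real.cos (Real.pi * (y + 2 * d / 3)) := by
  have h1 : d ≤ Real.sin (Real.pi * (y + d / 2)) := by
    rcases le_total (y + d / 2) (1 / 2) with h | h
    · linarith [two_mul_le_sin_pi (by positivity) h]
    · have := two_mul_le_sin_pi (w := 1 - (y + d / 2)) (by linarith) (by linarith)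
      rw [mul_sub Real.pi, mul_one, Real.sin_pi_sub] at this
      linarith
  have h2 : d / 3 ≤ Real.sin (Real.pi * (d / 6)) := by
    linarith [two_mul_le_sin_pi (w := d / 6) (by positivity) (by linarith)]
  have h3 : Real.cos (Real.pi * (y + d / 3)) - Real.cos (Real.pi * (y + 2 * d / 3)) =
      2 * (Real.sin (Real.pi * (y + d / 2)) * Real.sin (Real.pi * (d / 6))) := by
    rw [Real.cos_sub_cos]
    rw [show (Real.pi * (y + d / 3) + Real.pi * (y + 2 * d / 3)) / 2 = Real.pi * (y + d / 2) by ring,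
      show (Real.pi * (y + d / 3) - Real.pi * (y + 2 * d / 3)) / 2 = -(Real.pi * (d / 6)) by ring,
      Real.sin_neg]
    ring
  rw [h3]
  nlinarith [mul_le_mul h1 h2 (by positivity) (hd.trans h1)]

/-- On `k * [a, a + L]`, the cosines at the two trisection points are apart and separate the
outer thirds. -/
theorem Unfolded.cos_trisect {k : ℕ} {a L : ℝ} (h : Unfolded k a L) (hL : 0 ≤ L) :
    4 / 9 * (k * L) ^ 4 ≤ (Real.cos (Real.pi * (k * (a + L / 3))) -
      Real.cos (Real.pi * (k * (a + 2 * L / 3)))) ^ 2 ∧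
    (∀ t, a ≤ t → t ≤ a + L / 3 →
      0 ≤ (Real.cos (Real.pi * (k * t)) - Real.cos (Real.pi * (k * (a + L / 3)))) *
        (Real.cos (Real.pi * (k * (a + L / 3))) - Real.cos (Real.pi * (k * (a + 2 * L / 3))))) ∧
    (∀ t, a + 2 * L / 3 ≤ t → t ≤ a + L →
      0 ≤ (Real.cos (Real.pi * (k * (a + 2 * L / 3))) - Real.cos (Real.pi * (k * t))) *
        (Real.cos (Real.pi * (k * (a + L / 3))) -
          Real.cos (Real.pi * (k * (a + 2 * L / 3))))) := by
  obtain ⟨n, h1, h2⟩ := h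
  have hk : (0 : ℝ) ≤ k := Nat.cast_nonneg k
  have hkL : 0 ≤ k * L := by positivity
  -- Translating by `n` multiplies every cosine by `(-1)^n`, which cancels in products of
  -- differences. Orienting by the difference of the two cosines thus makes the parity of `n`
  -- irrelevant.
  have hs := neg_one_zpow_mul_self n
  have hgap := cos_pi_gap (y := k * a - n) (d := k * L) (by linarith) hkL (by linarith)
  rw [show k * a - n + k * L / 3 = k * (a + L / 3) - n by ring,
    show k * a - n + 2 * (k * L) / 3 = k * (a + 2 * L / 3) - n by ring] at hgap
  rw [cos_pi_mul_eq (k * (a + L / 3)) n, cos_pi_mul_eq (k * (a + 2 * L / 3)) n]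
  refine ⟨?_, fun t ht1 ht2 => ?_, fun t ht1 ht2 => ?_⟩
  · rw [← mul_sub, mul_pow ((-1 : ℝ) ^ n), sq ((-1 : ℝ) ^ n), hs, one_mul]
    calc 4 / 9 * (k * L) ^ 4 = (2 / 3 * (k * L) ^ 2) ^ 2 := by ring
      _ ≤ _ := by gcongr
  · rw [cos_pi_mul_eq (k * t) n, ← mul_sub, ← mul_sub, mul_mul_mul_comm, hs, one_mul]
    refine mul_nonneg (sub_nonneg.2 (cos_pi_antitone ?_ ?_ ?_))
      (le_trans (by positivity) hgap) <;>
      nlinarith [mul_le_mul_of_nonneg_left ht1 hk, mul_le_mul_of_nonneg_left ht2 hk]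
  · rw [cos_pi_mul_eq (k * t) n, ← mul_sub, ← mul_sub, mul_mul_mul_comm, hs, one_mul]
    refine mul_nonneg (sub_nonneg.2 (cos_pi_antitone ?_ ?_ ?_))
      (le_trans (by positivity) hgap) <;>
      nlinarith [mul_le_mul_of_nonneg_left ht1 hk, mul_le_mul_of_nonneg_left ht2 hk]

/-! ### Concentration of the test statistic and the number of repetitions. -/

/-- Moment generating function of the test statistic `(X - (c₁ + c₂) / 2) * D` of a sign `X` of
mean `c`. -/
theorem statistic_mgf_le {c c₁ c₂ D : ℝ} (hc : |c| ≤ 1) (hc₁ : |c₁| ≤ 1) (hc₂ : |c₂| ≤ 1)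
    (hD : |D| ≤ 2) (hmean : D ^ 2 / 2 ≤ (c - (c₁ + c₂) / 2) * D) :
    (1 + c) / 2 * Real.exp (-((1 - (c₁ + c₂) / 2) * D) / 16) +
      (1 - c) / 2 * Real.exp (-((-1 - (c₁ + c₂) / 2) * D) / 16) ≤ 1 - D ^ 2 / 64 := by
  rw [abs_le] at hc hc₁ hc₂
  -- This is `exp (-z) ≤ 1 - z + z²` at `z = rD / 16`, where `|z| ≤ 1` and `z² ≤ D² / 64`.
  -- Averaging, the drift gains at least `D² / 32`, twice the quadratic loss.
  have hexp : ∀ r : ℝ, |r| ≤ 2 →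
      Real.exp (-(r * D) / 16) ≤ 1 + -(r * D) / 16 + D ^ 2 / 64 := by
    intro r hr
    have hrD : |r * D| ≤ 4 := by
      rw [abs_mul]
      nlinarith [abs_nonneg r, abs_nonneg D]
    have h := Real.abs_exp_sub_one_sub_id_le (x := -(r * D) / 16) (by
      rw [abs_div, abs_neg, abs_of_pos (show (0 : ℝ) < 16 by norm_num)]
      linarith)
    have h' := (abs_le.1 h).2
    have hr2 : r ^ 2 ≤ 4 := by
      rw [← sq_abs]
      nlinarith [abs_nonneg r]
    nlinarith [mul_le_mul_of_nonneg_right hr2 (sq_nonneg D)]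
  have e1 := hexp (1 - (c₁ + c₂) / 2) (abs_le.2 ⟨by linarith, by linarith⟩)
  have e2 := hexp (-1 - (c₁ + c₂) / 2) (abs_le.2 ⟨by linarith, by linarith⟩)
  have e1' := mul_le_mul_of_nonneg_left e1 (show 0 ≤ (1 + c) / 2 by linarith)
  have e2' := mul_le_mul_of_nonneg_left e2 (show 0 ≤ (1 - c) / 2 by linarith)
  nlinarith

theorem exp_neg_nat_le (n : ℕ) : Real.exp (-(n : ℝ)) ≤ (1 / 2) ^ n := by
  have h : Real.exp (-1) ≤ 1 / 2 := by
    rw [Real.exp_neg, inv_le_comm₀ (Real.exp_pos _) (by norm_num)]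
    linarith [Real.add_one_le_exp (1 : ℝ)]
  calc Real.exp (-(n : ℝ)) = Real.exp (-1) ^ n := by
        rw [← Real.exp_nat_mul]
        ring_nf
    _ ≤ _ := by gcongr

/-- The number of repetitions makes a test fail with small probability. -/
theorem pow_repetitions_le {ρ : ℝ} (hρ0 : 0 ≤ ρ) (hρ : ρ ≤ 1 - 1 / 10 ^ 10) {l s lam n : ℕ}
    (hl : l ≤ 2 ^ lam) (hl1 : 1 ≤ l) (hlam : 1 ≤ lam)
    (hn : 6 * 10 ^ 10 * lam * (6 / 5 : ℝ) ^ s - 1 ≤ n) :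
    ρ ^ n ≤ (1 / 2) ^ s / (4 * l) := by
  have hb : 1 + (s : ℝ) * (1 / 5) ≤ (6 / 5 : ℝ) ^ s := by
    have := one_add_mul_le_pow (a := (1 / 5 : ℝ)) (by norm_num) s
    norm_num at this ⊢
    linarith
  have hlam' : (1 : ℝ) ≤ lam := by exact_mod_cast hlam
  have hlw : lam * (1 + (s : ℝ) * (1 / 5)) ≤ lam * (6 / 5 : ℝ) ^ s := by gcongr
  have h1 : ρ ≤ Real.exp (-(1 / 10 ^ 10)) := by
    linarith [Real.add_one_le_exp (-(1 / 10 ^ 10 : ℝ))]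
  have hs0 : (0 : ℝ) ≤ s := Nat.cast_nonneg s
  calc ρ ^ n ≤ Real.exp (-(1 / 10 ^ 10)) ^ n := by gcongr
    _ = Real.exp (-(n / 10 ^ 10)) := by
        rw [← Real.exp_nat_mul]
        ring_nf
    -- By Bernoulli the exponent is about `6 * lam * (1 + s / 5)` at least; the slack over `4 * lam
    -- + s` absorbs the rounding of `n`.
    _ ≤ Real.exp (-((4 * lam + s : ℕ) : ℝ)) := by
        rw [Real.exp_le_exp, neg_le_neg_iff]
        push_cast
        rw [le_div_iff₀ (by norm_num)]
        nlinarith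
    _ ≤ (1 / 2) ^ (4 * lam + s) := exp_neg_nat_le _
    _ ≤ (1 / 2) ^ s / (4 * l) := by
        rw [pow_add, pow_mul, le_div_iff₀ (by positivity)]
        have h2 : (l : ℝ) ≤ 2 ^ lam := by exact_mod_cast hl
        have h3 : ((1 / 2 : ℝ) ^ 4) ^ lam * (4 * l) ≤ 1 := by
          calc ((1 / 2 : ℝ) ^ 4) ^ lam * (4 * l) ≤ ((1 / 2 : ℝ) ^ 4) ^ lam * (4 * 2 ^ lam) := by
                gcongr
            _ = 4 * (1 / 8) ^ lam := by
                rw [mul_left_comm, ← mul_pow]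
                norm_num
            _ ≤ 4 * (1 / 8) ^ 1 := by
                gcongr ?_ * ?_
                exact pow_le_pow_of_le_one (by norm_num) (by norm_num) hlam
            _ ≤ 1 := by norm_num
        have h4 : (0 : ℝ) ≤ (1 / 2) ^ s := by positivity
        nlinarith

/-! ### The program text of the scheme. -/

namespace Expr

instance : Add Expr := ⟨.add⟩
instance : Sub Expr := ⟨.sub⟩
instance : Mul Expr := ⟨.mul⟩
instance : Div Expr := ⟨.div⟩

@[simp] theorem eval_add (M : ℕ → ℝ) (e f : Expr) : (e + f).eval M = e.eval M + f.eval M := rfl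
@[simp] theorem eval_sub (M : ℕ → ℝ) (e f : Expr) : (e - f).eval M = e.eval M - f.eval M := rfl
@[simp] theorem eval_mul (M : ℕ → ℝ) (e f : Expr) : (e * f).eval M = e.eval M * f.eval M := rfl
@[simp] theorem eval_div (M : ℕ → ℝ) (e f : Expr) : (e / f).eval M = e.eval M / f.eval M := rfl
@[simp] theorem eval_cosPi (M : ℕ → ℝ) (e : Expr) :
    (cosPi e).eval M = Real.cos (Real.pi * e.eval M) := rfl
@[simp] theorem eval_const (M : ℕ → ℝ) (c : ℚ) : (const c).eval M = (c : ℝ) := rfl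

end Expr

open QScheme.Expr QScheme.Program

variable {G : GibbsSystem Ω}

/-- Cells `0` to `3` hold the number of stages, the precision, the running product and the current
stage; cells `5` to `7` the number of rounds, the initial test weight and the repetition factor;
cells `9` to `11` the left end and the length of the current interval and the test weight. This
searches for the number of amplification steps in a test, with candidates in cell `12` and the
result in cell `13`. -/
def searchBody : Program 1 := block [
  put 12 (cell 12 + const 1),
  .ite (const 0 - cosPi (cell 12 * cell 9 - const (1 / 2)) *
      cosPi (cell 12 * (cell 9 + cell 10) - const (1 / 2)))
    .skip (put 13 (cell 12))]

def search : Program 1 := block [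
  put 12 (const 0), put 13 (const 1),
  .loop (const 1 / (const 10 * cell 10)) searchBody]

def amplifyStep : Program 1 := block [
  .phase 0 (const 1), .rotInv (cell 3) 0, .ctrlRefl (cell 3) 0, .phase 0 (const 1),
  .rot (cell 3) 0]

/-- Amplify, measure the flag, and add the outcome to the test statistic in cell `15`. Cells `14`
and `18` hold the two cosines to be compared, cell `16` the previous outcome. -/
def flip : Program 1 := block [
  .loop (cell 13) amplifyStep,
  observe 0 17,
  put 15 (cell 15 + ((const 1 - const 2 * ((cell 17 - cell 16) * (cell 17 - cell 16))) -
    (cell 14 + cell 18) / const 2) * (cell 14 - cell 18)),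
  put 16 (cell 17)]

/-- Discard one of the outer thirds of the current interval. -/
def round : Program 1 := block [
  search,
  put 14 (cosPi (cell 13 * (cell 9 + cell 10 / const 3))),
  put 18 (cosPi (cell 13 * (cell 9 + const 2 * cell 10 / const 3))),
  put 15 (const 0),
  .loop (const (6 * 10 ^ 10) * cell 7 * cell 11) flip,
  .ite (cell 15) .skip (put 9 (cell 9 + cell 10 / const 3)),
  put 10 (const (2 / 3) * cell 10),
  put 11 (const (5 / 6) * cell 11)]

/-- Multiply the running product by an estimate of the ratio of the current stage. -/
def stage : Program 1 := block [
  .sample (cell 3),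
  .ite (cell 16) .skip (block [.had 0, .phase 0 (const 1), .had 0]),
  .rot (cell 3) 0,
  observe 0 16,
  put 9 (const 0), put 10 (const 1), put 11 (cell 6),
  .loop (cell 5) round,
  put 2 (cell 2 * ((const 1 + cosPi (cell 9 / const 2)) / const 2)),
  put 3 (cell 3 + const 1)]

/-- Compute the number of rounds, the initial test weight and the repetition factor. -/
def setup : Program 1 := block [
  put 7 (const 1), put 8 (const 1),
  .loop (cell 0) (.ite (cell 0 - cell 8)
    (block [put 8 (cell 8 + cell 8), put 7 (cell 7 + const 1)]) .skip),
  put 6 (const 1), put 10 (const 1),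
  .loop (const 12 * cell 0 / cell 1) (.ite (cell 10 - cell 1 / (const 4 * cell 0))
    (block [put 10 (const (2 / 3) * cell 10), put 6 (const (6 / 5) * cell 6),
      put 5 (cell 5 + const 1)]) .skip)]

/-- The scheme. -/
def scheme : Program 1 := block [setup, .loop (cell 0) stage, put 0 (cell 2)]

/-! ### Correctness of the search for a multiplier. -/

/-- `u` differs from `s` at most in the memory cells in `A` and in the number of steps, which has
grown by at most `b`. -/
structure Config.Extends (A : Finset ℕ) (b : ℕ) (s u : Config Ω 1) : Prop where
  state : u.state = s.state
  samples : u.samples = s.samples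
  refls : u.refls = s.refls
  mem : ∀ j, j ∉ A → u.mem j = s.mem j
  steps : u.steps ≤ s.steps + b

/-- The search keeps the largest unfolding `k ≤ K = ⌊1 / (10L)⌋`, with default `1`, which always
works because the interval lies in `[0, 1]`. The upper bound on `k * L` limits the reflections, the
lower one guarantees a constant gap between the cosines. -/
theorem search_spec {s : Config Ω 1} (ha : 0 ≤ s.mem 9) (hL : 0 < s.mem 10)
    (haL : s.mem 9 + s.mem 10 ≤ 1) :
    ∃ u, search.run G s = {u} ∧ s.Extends {12, 13} (8 * ⌊1 / (10 * s.mem 10)⌋₊ + 8) u ∧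
      ∃ k : ℕ, u.mem 13 = k ∧ k * s.mem 10 ≤ 1 ∧ 1 / 80 ≤ k * s.mem 10 ∧
        Unfolded k (s.mem 9) (s.mem 10) := by
  set a := s.mem 9 with hadef
  set L := s.mem 10 with hLdef
  set K := ⌊1 / (10 * L)⌋₊ with hKdef
  have hKle : (K : ℝ) ≤ 1 / (10 * L) := Nat.floor_le (by positivity)
  have hKL : K * L ≤ 1 / 10 := by
    calc K * L ≤ 1 / (10 * L) * L := by gcongr
      _ = 1 / 10 := by field_simp
  have hL1 : L ≤ 1 := by linarith
  have hKlt : 1 / (10 * L) < K + 1 := Nat.lt_floor_add_one _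
  have hKlt' : 1 / 10 < (K + 1) * L := by
    calc 1 / 10 = 1 / (10 * L) * L := by field_simp
      _ < _ := by gcongr
  let I : ℕ → Config Ω 1 → Prop := fun j t =>
    s.Extends {12, 13} (8 * j + 6) t ∧ t.mem 12 = j ∧
    ∃ k : ℕ, t.mem 13 = k ∧ 1 ≤ k ∧ (k ≤ j ∨ k = 1) ∧ Unfolded k a L ∧
      ∀ k', 1 ≤ k' → k' ≤ j → Unfolded k' a L → k' ≤ k
  obtain ⟨s₁, hs₁, h1⟩ : ∃ s₁ : Config Ω 1, s₁ = (s.tick.write 12 0).tick.write 13 1 ∧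
      I 0 s₁.tick := by
    refine ⟨_, rfl, ⟨rfl, rfl, rfl, ?_, ?_⟩, ?_, 1, ?_, le_rfl, Or.inr rfl, ⟨0, ?_, ?_⟩, ?_⟩
    · intro j hj
      simp only [Finset.mem_insert, Finset.mem_singleton, not_or] at hj
      simp [Config.tick, Config.write, hj.1, hj.2]
    · simp [Config.tick, Config.write]
    · simp [Config.tick, Config.write]
    · simp [Config.tick, Config.write]
    · simpa using ha
    · simpa using haL
    · intro k' h1 h0
      omega
  have hcount : ⌊(const 1 / (const 10 * cell 10)).eval s₁.mem⌋₊ = K := by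
    simp [hs₁, Config.tick, Config.write, hKdef, hLdef]
  obtain ⟨t, ht, hI⟩ := run_loop_eq_singleton (G := G) (c := searchBody) hcount h1 (by
    rintro j hj t ⟨hext, h12, k, h13, hk1, hkj, hu, hmax⟩
    have h9 : t.mem 9 = a := hext.mem 9 (by decide)
    have h10 : t.mem 10 = L := hext.mem 10 (by decide)
    have hsmall : ((j + 1 : ℕ) : ℝ) * L < 1 := by
      have : ((j + 1 : ℕ) : ℝ) ≤ K := by exact_mod_cast hj
      nlinarith
    have hiff := unfolded_iff (a := a) hL.le hsmall
    push_cast at hiff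
    by_cases htest : Unfolded (j + 1) a L
    · refine ⟨(((t.tick.tick.write 12 (j + 1)).tick.tick.write 13 (j + 1))).tick, ?_, ?_, ?_, j + 1,
        ?_, by omega, Or.inl le_rfl, htest, fun k' _ h _ => h⟩
      · simp only [searchBody, run_block_cons, run_put, Multiset.singleton_bind, Program.run,
          run_block_nil]
        rw [if_neg]
        · simp [Config.tick, Config.write, h12]
        · simpa [Config.tick, Config.write, h9, h10, h12] using hiff.1 htest
      · refine ⟨hext.state, hext.samples, hext.refls, ?_, ?_⟩
        · intro i hi
          rw [← hext.mem i hi]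
          simp only [Finset.mem_insert, Finset.mem_singleton, not_or] at hi
          simp [Config.tick, Config.write, hi.1, hi.2]
        · have := hext.steps
          simp [Config.tick, Config.write]
          omega
      · simp [Config.tick, Config.write]
      · simp [Config.tick, Config.write]
    · refine ⟨((t.tick.tick.write 12 (j + 1)).tick.tick).tick, ?_, ?_, ?_, k, ?_, hk1,
        hkj.imp_left fun h => by omega, hu, fun k' h1 h2 h3 => ?_⟩
      · simp only [searchBody, run_block_cons, run_put, Multiset.singleton_bind, Program.run,
          run_block_nil]
        rw [if_pos]
        · simp [Config.tick, Config.write, h12]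
        · have := not_not.1 (mt hiff.2 htest)
          simpa [Config.tick, Config.write, h9, h10, h12] using this
      · refine ⟨hext.state, hext.samples, hext.refls, ?_, ?_⟩
        · intro i hi
          rw [← hext.mem i hi]
          simp only [Finset.mem_insert, Finset.mem_singleton, not_or] at hi
          simp [Config.tick, Config.write, hi.1]
        · have := hext.steps
          simp [Config.tick, Config.write]
          omega
      · simp [Config.tick, Config.write]
      · simp [Config.tick, Config.write, h13]
      · rcases Nat.lt_or_ge j k' with h | h
        · have : k' = j + 1 := by omega
          exact absurd (this ▸ h3) htest
        · exact hmax k' h1 h h3)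
  obtain ⟨hext, h12, k, h13, hk1, hkj, hu, hmax⟩ := hI
  refine ⟨t.tick, ?_, ⟨hext.state, hext.samples, hext.refls, hext.mem, ?_⟩, k, h13, ?_, ?_, hu⟩
  · rw [search, run_block_cons, run_put, Multiset.singleton_bind, run_block_cons, run_put,
      Multiset.singleton_bind, run_block_cons]
    simp only [eval_const, Rat.cast_zero, Rat.cast_one]
    rw [← hs₁, ht]
    rfl
  · have := hext.steps
    simp only [Config.tick]
    omega
  · rcases hkj with h | h
    · have : (k : ℝ) ≤ K := by exact_mod_cast h
      nlinarith
    · rw [h]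
      simpa using hL1
  · rcases Nat.eq_zero_or_pos K with h | h
    · rw [h] at hKlt'
      have : (1 : ℝ) ≤ k := by exact_mod_cast hk1
      norm_num at hKlt'
      nlinarith
    -- From `(K + 1) * L > 1/10` and `K + 1 ≤ 2K ≤ 8k` comes `k * L ≥ 1/80`.
    · obtain ⟨k', h1', h2', h3', h4'⟩ := exists_unfolded ha hL.le haL h hKL
      have h5 : K ≤ 4 * k := h3'.trans (by have := hmax k' h1' h2' h4'; omega)
      have h6 : (K : ℝ) ≤ 4 * k := by exact_mod_cast h5
      have h7 : (1 : ℝ) ≤ K := by exact_mod_cast h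
      nlinarith

/-! ### Single tests and their repetition. -/

theorem amplifyStep_spec {s : Config Ω 1} {i : ℕ} (hi : i < G.len) (h3 : s.mem 3 = i) :
    ∃ u, amplifyStep.run G s = {u} ∧ u.state = QState.amplify G i s.state ∧ u.mem = s.mem ∧
      u.samples = s.samples ∧ u.refls = Function.update s.refls i (s.refls i + 1) ∧
      u.steps = s.steps + 6 := by
  refine ⟨⟨QState.amplify G i s.state, s.mem, s.samples,
    Function.update s.refls i (s.refls i + 1), s.steps + 6⟩, ?_, rfl, rfl, rfl, rfl, rfl⟩
  simp only [amplifyStep, run_block_cons, run_block_nil, Multiset.singleton_bind, Program.run,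
    eval_cell, Config.act, Config.tick, Config.countRefl, h3, Nat.floor_natCast, if_pos hi]
  simp [QState.amplify]

theorem amplify_loop_spec {s : Config Ω 1} {i k : ℕ} (hi : i < G.len) (h3 : s.mem 3 = i)
    (h13 : s.mem 13 = k) :
    ∃ u, (Program.loop (cell 13) amplifyStep).run G s = {u} ∧
      u.state = (QState.amplify G i)^[k] s.state ∧ u.mem = s.mem ∧
      u.samples = s.samples ∧ u.refls = Function.update s.refls i (s.refls i + k) ∧
      u.steps = s.steps + 1 + 7 * k := by
  refine run_loop_eq_singleton (I := fun j u => u.state = (QState.amplify G i)^[j] s.state ∧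
    u.mem = s.mem ∧ u.samples = s.samples ∧
    u.refls = Function.update s.refls i (s.refls i + j) ∧ u.steps = s.steps + 1 + 7 * j)
    (by simp [h13]) ?_ ?_
  · simp [Config.tick]
  · rintro j _ t ⟨h1, h2, h4, h5, h6⟩
    obtain ⟨u, hu, g1, g2, g4, g5, g6⟩ := amplifyStep_spec (s := t.tick) hi
      (by simpa [Config.tick, h2] using h3)
    refine ⟨u, hu, ?_, ?_, ?_, ?_, ?_⟩
    · rw [g1, Function.iterate_succ_apply', ← h1]
      rfl
    · rw [g2, ← h2]
      rfl
    · rw [g4, ← h4]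
      rfl
    · rw [g5]
      simp [Config.tick, h5, add_assoc]
    · rw [g6]
      simp only [Config.tick]
      omega

/-- The flag value as a real number. -/
def bit (v : Bool) : ℝ := if v then 1 else 0

/-- The two states of the plane with a definite flag. -/
def axis (g u : Ω → ℝ) (v : Bool) (c : ℂ) : QState Ω 1 :=
  if v then QState.plane g u c 0 else QState.plane g u 0 c

theorem normSq_axis {i : ℕ} {θ : ℝ} {g u : Ω → ℝ} (hf : G.IsFrame i θ g u) (v : Bool) (c : ℂ) :
    (axis g u v c).normSq = ‖c‖ ^ 2 := by
  cases v <;> simp [axis, QState.normSq_plane hf.sum_sq_good hf.sum_sq_bad]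

/-- A test repeats the previous outcome with probability `cos (2kθ) ^ 2`. -/
theorem flip_spec {s : Config Ω 1} {i k : ℕ} {θ : ℝ} {g u : Ω → ℝ} (hf : G.IsFrame i θ g u)
    (hw : ∀ σ, G.weight i σ ≤ 1) (hi : i < G.len) (h3 : s.mem 3 = i)
    (h13 : s.mem 13 = k) {v : Bool} {c : ℂ} (hs : s.state = axis g u v c)
    (h16 : s.mem 16 = bit v) :
    ∃ t : Bool → Config Ω 1, flip.run G s = {t true, t false} ∧
      (t true).prob = (1 + Real.cos (4 * k * θ)) / 2 * s.prob ∧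
      (t false).prob = (1 - Real.cos (4 * k * θ)) / 2 * s.prob ∧
      ∀ b, (t b).mem 15 = s.mem 15 + ((if b then 1 else -1) - (s.mem 14 + s.mem 18) / 2) *
          (s.mem 14 - s.mem 18) ∧
        (∃ v' c', (t b).state = axis g u v' c' ∧ (t b).mem 16 = bit v') ∧
        (∀ j, j ∉ ({15, 16, 17} : Finset ℕ) → (t b).mem j = s.mem j) ∧
        (t b).samples = s.samples ∧
        (t b).refls = Function.update s.refls i (s.refls i + k) ∧
        (t b).steps = s.steps + 7 * k + 5 := by
  obtain ⟨r, hr, g1, g2, g4, g5, g6⟩ := amplify_loop_spec hi h3 h13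
  set o : Bool → Config Ω 1 := fun b => (((((r.act (QState.project 0 b)).write 17 (bit b)).tick.write
    15 (s.mem 15 + ((1 - 2 * ((bit b - s.mem 16) * (bit b - s.mem 16))) -
      (s.mem 14 + s.mem 18) / 2) * (s.mem 14 - s.mem 18)))).tick.write 16 (bit b)).tick with ho
  have hrun : flip.run G s = {o false, o true} := by
    rw [flip, run_block_cons, hr, Multiset.singleton_bind, run_block_cons, run_observe]
    simp only [Multiset.insert_eq_cons, Multiset.cons_bind, Multiset.singleton_bind,
      run_block_cons, run_put, run_block_nil, ho, ← g2, bit]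
    simp [Config.act, Config.tick, Config.write]
  have hcos : Real.cos (k * (2 * θ)) ^ 2 = (1 + Real.cos (4 * k * θ)) / 2 := by
    rw [Real.cos_sq]
    ring_nf
  have hsin : Real.sin (k * (2 * θ)) ^ 2 = (1 - Real.cos (4 * k * θ)) / 2 := by
    rw [Real.sin_sq, hcos]
    ring
  have hsp : s.prob = ‖c‖ ^ 2 := by rw [Config.prob, hs, normSq_axis hf]
  have hst : ∀ b, (o b).state = QState.project 0 b r.state := fun b => rfl
  have hrs := g1
  rw [hs] at hrs
  have hcommon : ∀ b, (∀ j, j ∉ ({15, 16, 17} : Finset ℕ) → (o b).mem j = s.mem j) ∧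
        (o b).samples = s.samples ∧
        (o b).refls = Function.update s.refls i (s.refls i + k) ∧
        (o b).steps = s.steps + 7 * k + 5 := by
    intro b
    refine ⟨fun j hj => ?_, ?_, ?_, ?_⟩
    · simp only [Finset.mem_insert, Finset.mem_singleton, not_or] at hj
      simp [ho, Config.act, Config.tick, Config.write, hj.1, hj.2.1, hj.2.2, g2]
    · simpa [ho, Config.act, Config.tick, Config.write] using g4
    · simpa [ho, Config.act, Config.tick, Config.write] using g5
    · simp [ho, Config.act, Config.tick, Config.write, g6]
      omega
  have h15 : ∀ b, (o b).mem 15 = s.mem 15 + ((1 - 2 * ((bit b - s.mem 16) * (bit b - s.mem 16))) -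
      (s.mem 14 + s.mem 18) / 2) * (s.mem 14 - s.mem 18) := by
    intro b
    simp [ho, Config.act, Config.tick, Config.write]
  have h16' : ∀ b, (o b).mem 16 = bit b := by
    intro b
    simp [ho, Config.act, Config.tick, Config.write]
  -- Branches are relabelled from the outcome to its agreement with the previous outcome `v`; in
  -- these terms the law no longer depends on `v`.
  refine ⟨fun b => o (b == v), ?_, ?_, ?_, ?_⟩
  · rw [hrun]
    cases v
    · rfl
    · exact Multiset.pair_comm _ _
  · rw [hsp, ← hcos, Config.prob, hst, hrs]
    cases v
    · simp [axis, QState.iterate_amplify_plane hf hw, QState.project_false_plane,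
        QState.normSq_plane hf.sum_sq_good hf.sum_sq_bad, -Complex.ofReal_cos, mul_pow]
      ring
    · simp [axis, QState.iterate_amplify_plane hf hw, QState.project_true_plane,
        QState.normSq_plane hf.sum_sq_good hf.sum_sq_bad, -Complex.ofReal_cos, mul_pow]
      ring
  · rw [hsp, ← hsin, Config.prob, hst, hrs]
    cases v
    · simp [axis, QState.iterate_amplify_plane hf hw, QState.project_true_plane,
        QState.normSq_plane hf.sum_sq_good hf.sum_sq_bad, -Complex.ofReal_sin, mul_pow]
      ring
    · simp [axis, QState.iterate_amplify_plane hf hw, QState.project_false_plane,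
        QState.normSq_plane hf.sum_sq_good hf.sum_sq_bad, -Complex.ofReal_sin, mul_pow]
      ring
  · intro b
    refine ⟨?_, ?_, hcommon _⟩
    · rw [h15, h16]
      cases v <;> cases b <;> simp [bit]
      all_goals norm_num
    · refine ⟨b == v, ?_⟩
      rw [hst, h16', hrs]
      cases v <;> cases b <;>
        simp only [axis, QState.iterate_amplify_plane hf hw, QState.project_true_plane,
          QState.project_false_plane, beq_self_eq_true, Bool.false_eq_true, if_false, if_true,
          and_true, show (true == false) = false from rfl, show (false == true) = false from rfl] <;>
        exact ⟨_, rfl⟩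

/-- The configurations after `j` tests with `k` amplification steps each, begun in `s₀`. -/
structure FlipInv (g u : Ω → ℝ) (i k : ℕ) (s₀ : Config Ω 1) (j : ℕ) (s : Config Ω 1) : Prop where
  mem : ∀ a, a ∉ ({15, 16, 17} : Finset ℕ) → s.mem a = s₀.mem a
  state : ∃ v c, s.state = axis g u v c ∧ s.mem 16 = bit v
  samples : s.samples = s₀.samples
  refls : s.refls = Function.update s₀.refls i (s₀.refls i + j * k)
  steps : s.steps = s₀.steps + 1 + j * (7 * k + 6)

/-- A Chernoff bound without explicit random variables: each test multiplies the branch sum of the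
exponentiated statistic by at most `1 - D² / 64`. The sign `r` covers both directions of error at
once. -/
theorem flip_loop_spec {s : Config Ω 1} {i k n : ℕ} {θ : ℝ} {g u : Ω → ℝ}
    (hf : G.IsFrame i θ g u) (hw : ∀ σ, G.weight i σ ≤ 1) (hi : i < G.len) (h3 : s.mem 3 = i)
    (h13 : s.mem 13 = k) (hs : ∃ v c, s.state = axis g u v c ∧ s.mem 16 = bit v)
    (h15 : s.mem 15 = 0) (h14 : |s.mem 14| ≤ 1) (h18 : |s.mem 18| ≤ 1) {e : Expr}
    (he : ⌊e.eval s.mem⌋₊ = n) :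
    Meets ((Program.loop e flip).run G s) s.prob (FlipInv g u i k s n) (fun _ => True) 0 ∧
    ∀ r : ℝ, r * r = 1 → (s.mem 14 - s.mem 18) ^ 2 / 2 ≤
        (Real.cos (4 * k * θ) - (s.mem 14 + s.mem 18) / 2) * (r * (s.mem 14 - s.mem 18)) →
      branchProb ((Program.loop e flip).run G s) (fun t => ¬ 0 < r * t.mem 15) ≤
        (1 - (s.mem 14 - s.mem 18) ^ 2 / 64) ^ n * s.prob := by
  have hD2 : |s.mem 14 - s.mem 18| ≤ 2 := by
    rw [abs_le] at *
    constructor <;> linarith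
  have h0 : FlipInv g u i k s 0 s.tick := by
    refine ⟨fun _ _ => rfl, hs, rfl, ?_, ?_⟩ <;> simp [Config.tick]
  have hstep : ∀ j t, FlipInv g u i k s j t → ∃ o : Bool → Config Ω 1,
      flip.run G t.tick = {o true, o false} ∧
      (o true).prob = (1 + Real.cos (4 * k * θ)) / 2 * t.prob ∧
      (o false).prob = (1 - Real.cos (4 * k * θ)) / 2 * t.prob ∧
      ∀ b, FlipInv g u i k s (j + 1) (o b) ∧ (o b).mem 15 = t.mem 15 +
        ((if b then 1 else -1) - (s.mem 14 + s.mem 18) / 2) * (s.mem 14 - s.mem 18) := by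
    rintro j t ⟨hm, ⟨v, c, hst, h16⟩, hsa, hre, hsteps⟩
    obtain ⟨o, hrun, hp1, hp2, ho⟩ := flip_spec (s := t.tick) (v := v) (c := c) hf hw hi
      ((hm 3 (by decide)).trans h3) ((hm 13 (by decide)).trans h13) hst h16
    refine ⟨o, hrun, hp1, hp2, fun b => ?_⟩
    obtain ⟨o1, o2, o3, o4, o5, o6⟩ := ho b
    refine ⟨⟨fun a ha => (o3 a ha).trans (hm a ha), o2, o4.trans hsa, ?_, ?_⟩, ?_⟩
    · rw [o5]
      simp only [Config.tick, hre, Function.update_idem, Function.update_self]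
      congr 1
      ring
    · rw [o6]
      simp only [Config.tick, hsteps]
      ring
    · have e14 : t.tick.mem 14 = s.mem 14 := hm 14 (by decide)
      have e18 : t.tick.mem 18 = s.mem 18 := hm 18 (by decide)
      rw [o1, e14, e18]
      rfl
  constructor
  · have := Meets.loop (G := G) (e := e) (c := flip) (s := s) (I := FlipInv g u i k s)
      (Q := fun _ _ => True) (δ := fun _ => 0) (fun _ => le_rfl) he h0 trivial (by
        intro j _ t ht
        obtain ⟨o, hrun, hp1, hp2, ho⟩ := hstep j t ht
        rw [hrun]
        refine ⟨?_, ?_, ?_⟩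
        · intro w hw
          simp only [Multiset.insert_eq_cons, Multiset.mem_cons, Multiset.mem_singleton] at hw
          rcases hw with rfl | rfl
          · exact (ho true).1
          · exact (ho false).1
        · rw [branchSum_pair, hp1, hp2]
          ring
        · simp [branchProb])
    simpa using this
  · intro r hr hmean
    have hrD : (r * (s.mem 14 - s.mem 18)) ^ 2 = (s.mem 14 - s.mem 18) ^ 2 := by
      rw [mul_pow, sq r, hr, one_mul]
    have hrabs : |r| = 1 := by
      have : |r| * |r| = 1 := by rw [← abs_mul, hr, abs_one]
      nlinarith [abs_nonneg r]
    have hmgf := statistic_mgf_le (D := r * (s.mem 14 - s.mem 18)) (Real.abs_cos_le_one (4 * k * θ))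
      h14 h18 (by rwa [abs_mul, hrabs, one_mul]) (by rwa [hrD])
    rw [hrD] at hmgf
    -- On a failing branch the exponent is nonnegative, so `f` dominates the probability; before the
    -- first test the two are equal.
    let f : Config Ω 1 → ℝ := fun t => t.prob * Real.exp (-(r * t.mem 15) / 16)
    have hρ : 0 ≤ 1 - (s.mem 14 - s.mem 18) ^ 2 / 64 := by
      have : (s.mem 14 - s.mem 18) ^ 2 ≤ 2 ^ 2 := sq_le_sq' (by linarith [(abs_le.1 hD2).1])
        (abs_le.1 hD2).2
      linarith
    have hit := branchSum_iterate_le (c := fun t => flip.run G t.tick) (I := FlipInv g u i k s)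
      (f := f) hρ h0 n (by
        intro j _ t ht w hw
        obtain ⟨o, hrun, hp1, hp2, ho⟩ := hstep j t ht
        rw [hrun] at hw
        simp only [Multiset.insert_eq_cons, Multiset.mem_cons, Multiset.mem_singleton] at hw
        rcases hw with rfl | rfl
        · exact (ho true).1
        · exact (ho false).1) (by
        intro j _ t ht
        obtain ⟨o, hrun, hp1, hp2, ho⟩ := hstep j t ht
        have hexp : ∀ x : ℝ, Real.exp (-(r * (t.mem 15 + x * (s.mem 14 - s.mem 18))) / 16) =
            Real.exp (-(r * t.mem 15) / 16) *
              Real.exp (-(x * (r * (s.mem 14 - s.mem 18))) / 16) := by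
          intro x
          rw [← Real.exp_add]
          congr 1
          ring
        rw [hrun, branchSum_pair]
        simp only [f]
        rw [hp1, hp2, (ho true).2, (ho false).2, hexp, hexp]
        simp only [if_true, Bool.false_eq_true, if_false]
        have hpos : 0 ≤ t.prob * Real.exp (-(r * t.mem 15) / 16) :=
          mul_nonneg t.state.normSq_nonneg (Real.exp_pos _).le
        linarith [mul_le_mul_of_nonneg_right hmgf hpos])
    have hf0 : f s.tick = s.prob := by
      simp [f, Config.tick, h15]
    rw [Program.run, he, ← hf0]
    refine (branchProb_le_branchSum (f := f)
      (fun t => mul_nonneg t.state.normSq_nonneg (Real.exp_pos _).le) ?_).trans hit.2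
    intro t _ ht
    refine le_mul_of_one_le_right t.state.normSq_nonneg (Real.one_le_exp ?_)
    linarith

/-! ### Rounds of the trisection. -/

/-- Bound for the steps of one round. -/
def roundSteps (lam R : ℕ) : ℝ := 10 ^ 13 * lam * ((3 / 2) ^ R) ^ 2

/-- The configurations after `r` of `R` rounds of stage `i`, begun in `s₀`. -/
structure RoundInv (g u : Ω → ℝ) (i lam R : ℕ) (s₀ : Config Ω 1) (r : ℕ) (s : Config Ω 1) :
    Prop where
  mem : ∀ a < 8, s.mem a = s₀.mem a
  left_nonneg : 0 ≤ s.mem 9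
  right_le : s.mem 9 + s.mem 10 ≤ 1
  length : s.mem 10 = (2 / 3) ^ r
  weight : s.mem 11 = (6 / 5) ^ (R - r)
  state : ∃ v c, s.state = axis g u v c ∧ s.mem 16 = bit v
  samples : s.samples = s₀.samples
  refls : ∀ j ≠ i, s.refls j = s₀.refls j
  refls_le : (s.refls i : ℝ) ≤
    s₀.refls i + 6 * 10 ^ 10 * lam * (6 / 5) ^ R * (4 * ((5 / 4) ^ r - 1))
  steps : (s.steps : ℝ) ≤ s₀.steps + r * roundSteps lam R

/-- The tests of a round tell the outer thirds of the current interval apart. -/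
theorem trisect_meets {s : Config Ω 1} {i k lam p : ℕ} {τ a L : ℝ} {g u : Ω → ℝ}
    (hf : G.IsFrame i (Real.pi * τ / 4) g u) (hw : ∀ σ, G.weight i σ ≤ 1) (hi : i < G.len)
    (h3 : s.mem 3 = i) (h7 : s.mem 7 = lam) (hlam : 1 ≤ lam) (hlen : G.len ≤ 2 ^ lam)
    (h11 : s.mem 11 = (6 / 5) ^ p) (h13 : s.mem 13 = k)
    (hs : ∃ v c, s.state = axis g u v c ∧ s.mem 16 = bit v) (h15 : s.mem 15 = 0)
    (h14 : s.mem 14 = Real.cos (Real.pi * (k * (a + L / 3))))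
    (h18 : s.mem 18 = Real.cos (Real.pi * (k * (a + 2 * L / 3))))
    (hL : 0 ≤ L) (hkL : 1 / 80 ≤ k * L) (hunf : Unfolded k a L) :
    ∃ n : ℕ, (n : ℝ) ≤ 6 * 10 ^ 10 * lam * (6 / 5) ^ p ∧
      Meets ((Program.loop (const (6 * 10 ^ 10) * cell 7 * cell 11) flip).run G s) s.prob
        (FlipInv g u i k s n)
        (fun t => a ≤ τ ∧ τ ≤ a + L →
          (0 < t.mem 15 → τ ≤ a + 2 * L / 3) ∧ (¬ 0 < t.mem 15 → a + L / 3 ≤ τ))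
        ((1 / 2) ^ p / (4 * G.len)) := by
  obtain ⟨n, hn⟩ : ∃ n, n = ⌊6 * 10 ^ 10 * lam * (6 / 5 : ℝ) ^ p⌋₊ := ⟨_, rfl⟩
  have hcount : ⌊(const (6 * 10 ^ 10) * cell 7 * cell 11).eval s.mem⌋₊ = n := by
    simp only [eval_mul, eval_const, eval_cell, h7, h11, hn]
    norm_num
  have hnle : (n : ℝ) ≤ 6 * 10 ^ 10 * lam * (6 / 5 : ℝ) ^ p := by
    rw [hn]
    exact Nat.floor_le (by positivity)
  have hfloor : 6 * 10 ^ 10 * lam * (6 / 5 : ℝ) ^ p - 1 ≤ n := by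
    rw [sub_le_iff_le_add, hn]
    exact (Nat.lt_floor_add_one _).le
  clear hn
  refine ⟨n, hnle, ?_⟩
  obtain ⟨hsure, hfail⟩ := flip_loop_spec hf hw hi h3 h13 hs h15
    (by rw [h14]; exact Real.abs_cos_le_one _) (by rw [h18]; exact Real.abs_cos_le_one _) hcount
  have hc₁ := abs_le.1 (Real.abs_cos_le_one (Real.pi * (k * (a + L / 3))))
  have hc₂ := abs_le.1 (Real.abs_cos_le_one (Real.pi * (k * (a + 2 * L / 3))))
  obtain ⟨hgap, hleft, hright⟩ := hunf.cos_trisect hL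
  rw [h14, h18] at hfail
  generalize Real.cos (Real.pi * (k * (a + L / 3))) = c₁ at *
  generalize Real.cos (Real.pi * (k * (a + 2 * L / 3))) = c₂ at *
  have hcos : Real.cos (4 * k * (Real.pi * τ / 4)) = Real.cos (Real.pi * (k * τ)) := by
    congr 1
    ring
  rw [hcos] at hfail
  -- Here `(4/9) * (1/80)^4 / 64` exceeds `10^(-10)`.
  have hρ1 : 1 - (c₁ - c₂) ^ 2 / 64 ≤ 1 - 1 / 10 ^ 10 := by
    have : (1 / 80 : ℝ) ^ 4 ≤ (k * L) ^ 4 := by gcongr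
    norm_num at this ⊢
    linarith
  have hρ0 : 0 ≤ 1 - (c₁ - c₂) ^ 2 / 64 := by nlinarith
  have hpow := pow_repetitions_le hρ0 hρ1 hlen (by omega) hlam hfloor
  have hp := mul_le_mul_of_nonneg_right hpow s.state.normSq_nonneg
  have htriv : branchProb ((Program.loop (const (6 * 10 ^ 10) * cell 7 * cell 11) flip).run G s)
      (fun _ => False) ≤ (1 / 2) ^ p / (4 * G.len) * s.prob := by
    have : 0 ≤ (1 / 2 : ℝ) ^ p / (4 * G.len) * s.prob :=
      mul_nonneg (by positivity) s.state.normSq_nonneg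
    simpa [branchProb] using this
  refine ⟨hsure.sure, hsure.mass, ?_⟩
  by_cases hτ : a ≤ τ ∧ τ ≤ a + L
  · rcases le_or_gt τ (a + L / 3) with h1 | h1
    · refine le_trans ?_ ((hfail 1 (by norm_num) ?_).trans hp)
      · refine branchProb_mono fun t _ ht hpos => ht fun _ => ⟨fun _ => by linarith, fun h => ?_⟩
        rw [one_mul] at hpos
        exact absurd hpos h
      -- With `D = c₁ - c₂`, the drift is `(c - c₁) * D + D² / 2`, and the first term is nonnegative
      -- in the left third. The right third is the same with the sign reversed.
      · nlinarith [hleft τ hτ.1 h1]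
    · rcases le_or_gt (a + 2 * L / 3) τ with h2 | h2
      · refine le_trans ?_ ((hfail (-1) (by norm_num) ?_).trans hp)
        · refine branchProb_mono fun t _ ht hpos => ht fun _ => ⟨fun h => ?_, fun _ => h1.le⟩
          linarith
        · nlinarith [hright τ h2 hτ.2]
      · exact (branchProb_mono fun t _ ht => ht fun _ => ⟨fun _ => h2.le, fun _ => h1.le⟩).trans
          htriv
  · exact (branchProb_mono fun t _ ht => ht fun h => absurd h hτ).trans htriv

/-- The end of a round: shorten the interval and lower the weight. -/
def shrink : Program 1 := block [
  .ite (cell 15) .skip (put 9 (cell 9 + cell 10 / const 3)),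
  put 10 (const (2 / 3) * cell 10),
  put 11 (const (5 / 6) * cell 11)]

theorem shrink_spec (t : Config Ω 1) : ∃ w, shrink.run G t = {w} ∧
    w.mem 9 = (if 0 < t.mem 15 then t.mem 9 else t.mem 9 + t.mem 10 / 3) ∧
    w.mem 10 = 2 / 3 * t.mem 10 ∧ w.mem 11 = 5 / 6 * t.mem 11 ∧
    t.Extends {9, 10, 11} 5 w := by
  by_cases hpos : 0 < t.mem 15
  · refine ⟨((t.tick.tick.tick.write 10 (2 / 3 * t.mem 10)).tick.write 11
      (5 / 6 * t.mem 11)).tick, ?_, ?_, ?_, ?_, rfl, rfl, rfl, ?_, le_rfl⟩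
    · simp [shrink, run_block_cons, run_block_nil, Program.run, hpos, Config.tick, Config.write]
    · simp [hpos, Config.tick, Config.write]
    · simp [Config.tick, Config.write]
    · simp [Config.tick, Config.write]
    · intro j hj
      simp only [Finset.mem_insert, Finset.mem_singleton, not_or] at hj
      simp [Config.tick, Config.write, hj]
  · refine ⟨(((t.tick.tick.write 9 (t.mem 9 + t.mem 10 / 3)).tick.write 10
      (2 / 3 * t.mem 10)).tick.write 11 (5 / 6 * t.mem 11)).tick, ?_, ?_, ?_, ?_, rfl, rfl, rfl,
      ?_, le_rfl⟩
    · simp [shrink, run_block_cons, run_block_nil, Program.run, hpos, Config.tick, Config.write]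
    · simp [hpos, Config.tick, Config.write]
    · simp [Config.tick, Config.write]
    · simp [Config.tick, Config.write]
    · intro j hj
      simp only [Finset.mem_insert, Finset.mem_singleton, not_or] at hj
      simp [Config.tick, Config.write, hj]

theorem prepare_spec {s : Config Ω 1} (ha : 0 ≤ s.mem 9) (hL : 0 < s.mem 10)
    (haL : s.mem 9 + s.mem 10 ≤ 1) :
    ∃ u, round.run G s = ((Program.loop (const (6 * 10 ^ 10) * cell 7 * cell 11) flip).run G u).bind
        (fun t => shrink.run G t) ∧
      s.Extends {12, 13, 14, 15, 18} (8 * ⌊1 / (10 * s.mem 10)⌋₊ + 11) u ∧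
      ∃ k : ℕ, u.mem 13 = k ∧ k * s.mem 10 ≤ 1 ∧ 1 / 80 ≤ k * s.mem 10 ∧
        Unfolded k (s.mem 9) (s.mem 10) ∧ u.mem 15 = 0 ∧
        u.mem 14 = Real.cos (Real.pi * (k * (s.mem 9 + s.mem 10 / 3))) ∧
        u.mem 18 = Real.cos (Real.pi * (k * (s.mem 9 + 2 * s.mem 10 / 3))) := by
  obtain ⟨s₁, hrun₁, hext, k, h13, hkL, hkL', hunf⟩ := search_spec (G := G) ha hL haL
  have h9 : s₁.mem 9 = s.mem 9 := hext.mem 9 (by decide)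
  have h10 : s₁.mem 10 = s.mem 10 := hext.mem 10 (by decide)
  refine ⟨((s₁.tick.write 14 (Real.cos (Real.pi * (k * (s.mem 9 + s.mem 10 / 3))))).tick.write 18
    (Real.cos (Real.pi * (k * (s.mem 9 + 2 * s.mem 10 / 3))))).tick.write 15 0, ?_,
    ⟨hext.state, hext.samples, hext.refls, ?_, ?_⟩, k, ?_, hkL, hkL', hunf, ?_, ?_, ?_⟩
  · rw [round, run_block_cons, hrun₁, Multiset.singleton_bind, run_block_cons, run_put,
      Multiset.singleton_bind, run_block_cons, run_put, Multiset.singleton_bind, run_block_cons,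
      run_put, Multiset.singleton_bind, run_block_cons]
    simp only [eval_mul, eval_add, eval_div, eval_const, eval_cell, eval_cosPi, Config.tick,
      Config.write, h13, h9, h10, ne_eq, Function.update_of_ne,
      Nat.reduceEqDiff, not_false_eq_true, Rat.cast_ofNat, Rat.cast_zero]
    rfl
  · intro j hj
    simp only [Finset.mem_insert, Finset.mem_singleton, not_or] at hj
    rw [← hext.mem j (by simp [hj])]
    simp [Config.tick, Config.write, hj]
  · have := hext.steps
    simp only [Config.tick, Config.write]
    omega
  all_goals simp [Config.tick, Config.write, h13]

/-- The geometry and cost of the interval evolve in the same controlled way whether or not the test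
was right; only the containment of `τ` is subject to failure. -/
theorem round_meets {s₀ s : Config Ω 1} {i lam R r : ℕ} {τ : ℝ} {g u : Ω → ℝ}
    (hf : G.IsFrame i (Real.pi * τ / 4) g u) (hw : ∀ σ, G.weight i σ ≤ 1) (hi : i < G.len)
    (h3 : s₀.mem 3 = i) (h7 : s₀.mem 7 = lam) (hlam : 1 ≤ lam) (hlen : G.len ≤ 2 ^ lam)
    (hr : r < R) (hs : RoundInv g u i lam R s₀ r s) :
    Meets (round.run G s.tick) s.prob (RoundInv g u i lam R s₀ (r + 1))
      (fun t => s.mem 9 ≤ τ ∧ τ ≤ s.mem 9 + s.mem 10 → t.mem 9 ≤ τ ∧ τ ≤ t.mem 9 + t.mem 10)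
      ((1 / 2) ^ (R - r) / (4 * G.len)) := by
  have hLpos : 0 < s.mem 10 := by
    rw [hs.length]
    positivity
  obtain ⟨s₂, hrun, hext, k, h13, hkL, hkL', hunf, h15, h14, h18⟩ := prepare_spec (G := G)
    (s := s.tick) hs.left_nonneg hLpos hs.right_le
  change k * s.mem 10 ≤ 1 at hkL
  change 1 / 80 ≤ k * s.mem 10 at hkL'
  change Unfolded k (s.mem 9) (s.mem 10) at hunf
  have hmem₂ : ∀ j, j ∉ ({12, 13, 14, 15, 18} : Finset ℕ) → s₂.mem j = s.mem j := hext.mem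
  have hprob₂ : s₂.prob = s.prob := by
    rw [Config.prob, hext.state]
    rfl
  obtain ⟨n, hn, hflips⟩ := trisect_meets (s := s₂) hf hw hi
    ((hmem₂ 3 (by decide)).trans ((hs.mem 3 (by decide)).trans h3))
    ((hmem₂ 7 (by decide)).trans ((hs.mem 7 (by decide)).trans h7)) hlam hlen
    ((hmem₂ 11 (by decide)).trans hs.weight) h13
    (by rw [hext.state, hmem₂ 16 (by decide)]; exact hs.state) h15 h14 h18 hLpos.le hkL' hunf
  rw [hprob₂] at hflips
  rw [hrun, ← add_zero ((1 / 2 : ℝ) ^ (R - r) / (4 * G.len))]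
  refine hflips.bind le_rfl fun t ht => ?_
  obtain ⟨w, hw, hw9, hw10, hw11, hwext⟩ := shrink_spec (G := G) t
  rw [ht.mem 9 (by decide), hmem₂ 9 (by decide), ht.mem 10 (by decide), hmem₂ 10 (by decide)] at hw9
  rw [ht.mem 10 (by decide), hmem₂ 10 (by decide)] at hw10
  rw [ht.mem 11 (by decide), hmem₂ 11 (by decide)] at hw11
  have hRr : R - r = (R - (r + 1)) + 1 := by omega
  have hX : s.mem 10 * (3 / 2) ^ r = 1 := by
    rw [hs.length, ← mul_pow]
    norm_num
  have hXpos : (0 : ℝ) < (3 / 2) ^ r := by positivity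
  have hk : (k : ℝ) ≤ (3 / 2) ^ r := by
    calc (k : ℝ) = k * s.mem 10 * (3 / 2) ^ r := by rw [mul_assoc, hX, mul_one]
      _ ≤ 1 * (3 / 2) ^ r := by gcongr
      _ = _ := one_mul _
  rw [hw]
  refine Meets.singleton (by rw [Config.prob, hwext.state]) ?_ ?_
  · refine ⟨?_, ?_, ?_, ?_, ?_, ?_, ?_, ?_, ?_, ?_⟩
    · intro j hj
      rw [hwext.mem j (by simp; omega), ht.mem j (by simp; omega), hmem₂ j (by simp; omega),
        hs.mem j hj]
    · have := hs.left_nonneg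
      rw [hw9]
      split_ifs <;> positivity
    · have := hs.right_le
      rw [hw9, hw10]
      split_ifs <;> linarith
    · rw [hw10, hs.length, pow_succ]
      ring
    · rw [hw11, hs.weight, hRr, pow_succ]
      ring
    · obtain ⟨v, c, hv, hb⟩ := ht.state
      exact ⟨v, c, hwext.state.trans hv, (hwext.mem 16 (by decide)).trans hb⟩
    · rw [hwext.samples, ht.samples, ← hs.samples, hext.samples]
      rfl
    · intro j hj
      rw [hwext.refls, ht.refls, Function.update_of_ne hj, ← hs.refls j hj, hext.refls]
      rfl
    · rw [hwext.refls, ht.refls, Function.update_self, hext.refls]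
      simp only [Config.tick]
      push_cast
      -- Round `r` costs at most a constant times `lam * (6/5)^R * (5/4)^r` reflections; the
      -- invariant holds the geometric sum `∑_{j<r} (5/4)^j = 4((5/4)^r - 1)`.
      have h1 : (n : ℝ) * k ≤ 6 * 10 ^ 10 * lam * (6 / 5 : ℝ) ^ (R - r) * (3 / 2) ^ r := by gcongr
      have h2 : (6 / 5 : ℝ) ^ (R - r) * (3 / 2) ^ r = (6 / 5) ^ R * (5 / 4) ^ r := by
        conv_rhs => rw [← Nat.sub_add_cancel hr.le, pow_add, mul_assoc, ← mul_pow]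
        norm_num
      rw [mul_assoc, h2] at h1
      rw [pow_succ (5 / 4 : ℝ)]
      linarith [hs.refls_le]
    · have h1 : w.steps ≤ s.steps + (8 * ⌊1 / (10 * s.mem 10)⌋₊ + 18 + n * (7 * k + 6)) := by
        have h1 := hwext.steps
        have h2 := ht.steps
        have h3 : s₂.steps ≤ s.steps + 1 + (8 * ⌊1 / (10 * s.mem 10)⌋₊ + 11) := hext.steps
        omega
      have h2 : (w.steps : ℝ) ≤
          s.steps + (8 * (⌊1 / (10 * s.mem 10)⌋₊ : ℝ) + 18 + n * (7 * k + 6)) := by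
        exact_mod_cast h1
      have hX1 : (1 : ℝ) ≤ (3 / 2) ^ R := one_le_pow₀ (by norm_num)
      have hXr : (3 / 2 : ℝ) ^ r ≤ (3 / 2) ^ R := pow_le_pow_right₀ (by norm_num) hr.le
      have h3 : (⌊1 / (10 * s.mem 10)⌋₊ : ℝ) ≤ (3 / 2) ^ R := by
        refine (Nat.floor_le (by positivity)).trans (le_trans ?_ hXr)
        rw [div_le_iff₀ (by positivity)]
        linarith
      have h4 : (n : ℝ) ≤ 6 * 10 ^ 10 * lam * (3 / 2) ^ R := by
        refine hn.trans ?_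
        gcongr ?_ * ?_
        calc (6 / 5 : ℝ) ^ (R - r) ≤ (3 / 2) ^ (R - r) :=
              pow_le_pow_left₀ (by norm_num) (by norm_num) _
          _ ≤ (3 / 2) ^ R := pow_le_pow_right₀ (by norm_num) (Nat.sub_le _ _)
      have h5 : (7 * k + 6 : ℝ) ≤ 13 * (3 / 2) ^ R := by linarith
      have h6 : (n : ℝ) * (7 * k + 6) ≤ 6 * 10 ^ 10 * lam * (3 / 2) ^ R * (13 * (3 / 2) ^ R) := by
        gcongr
      have hlam' : (1 : ℝ) ≤ lam := by exact_mod_cast hlam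
      have h7 : (3 / 2 : ℝ) ^ R ≤ lam * ((3 / 2) ^ R) ^ 2 := by
        calc (3 / 2 : ℝ) ^ R ≤ ((3 / 2) ^ R) ^ 2 := le_self_pow₀ hX1 two_ne_zero
          _ ≤ lam * ((3 / 2) ^ R) ^ 2 := le_mul_of_one_le_left (by positivity) hlam'
      have h8 := hs.steps
      rw [roundSteps] at h8 ⊢
      push_cast
      linarith
  · intro hQ hτ
    obtain ⟨hQ1, hQ2⟩ := hQ hτ
    change 0 < t.mem 15 → τ ≤ s.mem 9 + 2 * s.mem 10 / 3 at hQ1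
    rw [hw9, hw10]
    split_ifs with hpos
    · exact ⟨hτ.1, by linarith [hQ1 hpos]⟩
    · exact ⟨hQ2 hpos, by linarith [hτ.2]⟩

theorem sum_half_pow (R : ℕ) :
    ∑ r ∈ Finset.range R, (1 / 2 : ℝ) ^ (R - r) = 1 - (1 / 2) ^ R := by
  induction R with
  | zero => simp
  | succ R ih =>
    rw [Finset.sum_range_succ']
    simp only [Nat.add_sub_add_right, Nat.sub_zero, ih]
    rw [pow_succ]
    ring

theorem rounds_meet {s : Config Ω 1} {i lam R : ℕ} {τ : ℝ} {g u : Ω → ℝ}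
    (hf : G.IsFrame i (Real.pi * τ / 4) g u) (hw : ∀ σ, G.weight i σ ≤ 1) (hi : i < G.len)
    (h3 : s.mem 3 = i) (h5 : s.mem 5 = R) (h7 : s.mem 7 = lam) (hlam : 1 ≤ lam)
    (hlen : G.len ≤ 2 ^ lam) (h9 : s.mem 9 = 0) (h10 : s.mem 10 = 1)
    (h11 : s.mem 11 = (6 / 5) ^ R) (hs : ∃ v c, s.state = axis g u v c ∧ s.mem 16 = bit v)
    (hτ0 : 0 ≤ τ) (hτ1 : τ ≤ 1) :
    Meets ((Program.loop (cell 5) round).run G s) s.prob (RoundInv g u i lam R s.tick R)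
      (fun t => t.mem 9 ≤ τ ∧ τ ≤ t.mem 9 + t.mem 10) (1 / (4 * G.len)) := by
  have hlen0 : (0 : ℝ) < 4 * G.len := by
    have : (0 : ℝ) < G.len := by exact_mod_cast Nat.zero_lt_of_lt hi
    positivity
  refine (Meets.loop (I := RoundInv g u i lam R s.tick)
    (Q := fun _ t => t.mem 9 ≤ τ ∧ τ ≤ t.mem 9 + t.mem 10)
    (δ := fun r => (1 / 2) ^ (R - r) / (4 * G.len)) (n := R) (fun _ => by positivity)
    (by simp [h5]) ?_ ?_ fun r hr t ht =>
      round_meets hf hw hi h3 h7 hlam hlen hr ht).mono (fun _ h => h) (fun _ _ h => h) ?_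
  · refine ⟨fun _ _ => rfl, ?_, ?_, ?_, ?_, hs, rfl, fun _ _ => rfl, ?_, ?_⟩
    · exact h9.ge
    · change s.mem 9 + s.mem 10 ≤ 1
      rw [h9, h10]
      norm_num
    · change s.mem 10 = _
      rw [h10, pow_zero]
    · exact h11
    · simp
    · simp
  · change s.mem 9 ≤ τ ∧ τ ≤ s.mem 9 + s.mem 10
    rw [h9, h10]
    exact ⟨hτ0, by linarith⟩
  -- The failure probabilities double from round to round and sum to less than `1 / (4ℓ)`.
  · rw [← Finset.sum_div, sum_half_pow]
    gcongr
    linarith [show (0 : ℝ) < (1 / 2) ^ R by positivity]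

/-! ### Stages: from the angle to the ratio. -/

/-- `x` approximates `Z_i` with relative error about `i * δ`. -/
def Approximates (G : GibbsSystem Ω) (δ : ℝ) (i : ℕ) (x : ℝ) : Prop :=
  G.Z i * (1 - δ) ^ i ≤ x ∧ x ≤ G.Z i * (1 + δ) ^ i

/-- The map `a ↦ (1 + cos (πa/2)) / 2` has Lipschitz constant at most `1`, because `π ≤ 4`. The
absolute error `δ/2` is therefore a relative error at most `δ`, as the ratio is at least `1/2`. -/
theorem Approximates.mul_estimate [Nonempty Ω] {δ : ℝ} {i : ℕ} {x a τ : ℝ}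
    (h : Approximates G δ i x) (hδ : δ ≤ 1) (hδ0 : 0 ≤ δ)
    (hτ : (1 + Real.cos (Real.pi * (τ / 2))) / 2 = G.ratio i) (hα : 1 / 2 ≤ G.ratio i)
    (ha : |a - τ| ≤ δ / 2) :
    Approximates G δ (i + 1) (x * ((1 + Real.cos (Real.pi * (a / 2))) / 2)) := by
  have hZ := G.Z_pos i
  have hZ' : G.Z (i + 1) = G.Z i * G.ratio i := by
    rw [GibbsSystem.ratio, mul_div_cancel₀ _ hZ.ne']
  have hcos := Real.abs_cos_sub_cos_le (Real.pi * (a / 2)) (Real.pi * (τ / 2))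
  have hdiff : |Real.pi * (a / 2) - Real.pi * (τ / 2)| ≤ δ := by
    rw [show Real.pi * (a / 2) - Real.pi * (τ / 2) = Real.pi / 2 * (a - τ) by ring, abs_mul,
      abs_of_pos (by positivity : 0 < Real.pi / 2)]
    nlinarith [Real.pi_le_four, Real.pi_pos, abs_nonneg (a - τ)]
  have he := abs_le.1 (hcos.trans hdiff)
  have he0 : 0 ≤ (1 + Real.cos (Real.pi * (a / 2))) / 2 := by
    linarith [Real.neg_one_le_cos (Real.pi * (a / 2))]
  generalize Real.cos (Real.pi * (a / 2)) = ca at *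
  generalize Real.cos (Real.pi * (τ / 2)) = ct at *
  have h1 : G.ratio i * (1 - δ) ≤ (1 + ca) / 2 := by nlinarith
  have h2 : (1 + ca) / 2 ≤ G.ratio i * (1 + δ) := by nlinarith
  have hx : 0 ≤ x := le_trans (mul_nonneg hZ.le (pow_nonneg (by linarith) _)) h.1
  constructor
  · calc G.Z (i + 1) * (1 - δ) ^ (i + 1) = (G.Z i * (1 - δ) ^ i) * (G.ratio i * (1 - δ)) := by
          rw [hZ', pow_succ]
          ring
      _ ≤ x * ((1 + ca) / 2) := by
          refine mul_le_mul h.1 h1 (mul_nonneg (by linarith) (by linarith)) hx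
  · calc x * ((1 + ca) / 2) ≤ (G.Z i * (1 + δ) ^ i) * (G.ratio i * (1 + δ)) :=
          mul_le_mul h.2 h2 he0 (by positivity)
      _ = G.Z (i + 1) * (1 + δ) ^ (i + 1) := by
          rw [hZ', pow_succ]
          ring

/-- The normalisation `θ = πτ/4` is possible since `α ≥ 1/2` means `arccos √α ≤ π/4`. It makes the
mean of a test `cos (πkτ)`. -/
theorem exists_angle {α : ℝ} (h0 : 1 / 2 ≤ α) (h1 : α ≤ 1) : ∃ τ, 0 ≤ τ ∧ τ ≤ 1 ∧
    Real.cos (Real.pi * τ / 4) ^ 2 = α ∧ (1 + Real.cos (Real.pi * (τ / 2))) / 2 = α := by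
  have hpi := Real.pi_pos
  have hcos : Real.cos (Real.arccos (√α)) ^ 2 = α := by
    rw [Real.cos_arccos (by linarith [Real.sqrt_nonneg α]) (Real.sqrt_le_one.2 h1),
      Real.sq_sqrt (by linarith)]
  have hle : Real.arccos (√α) ≤ Real.pi / 4 := by
    rw [Real.arccos_le_pi_div_four]
    rw [show √2 / 2 = √(1 / 2) by
      rw [Real.sqrt_div (by norm_num), Real.sqrt_one, div_eq_div_iff (by norm_num) (by positivity)]
      norm_num]
    exact Real.sqrt_le_sqrt h0
  have hθ : Real.pi * (4 * Real.arccos (√α) / Real.pi) / 4 = Real.arccos (√α) := by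
    field_simp
  refine ⟨4 * Real.arccos (√α) / Real.pi, ?_, ?_, ?_, ?_⟩
  · have := Real.arccos_nonneg (√α)
    positivity
  · rw [div_le_one hpi]
    linarith
  · rw [hθ, hcos]
  · rw [show Real.pi * (4 * Real.arccos (√α) / Real.pi / 2) = 2 * Real.arccos (√α) by
      field_simp; ring, Real.cos_two_mul, hcos]
    ring

/-- Bound for the reflections of one stage. -/
def stageRefls (lam R : ℕ) : ℝ := 24 * 10 ^ 10 * lam * (3 / 2) ^ R

/-- Bound for the steps of one stage. -/
def stageSteps (lam R : ℕ) : ℝ := 30 + R * roundSteps lam R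

/-- The configurations before stage `i`. -/
structure StageInv (s₀ : Config Ω 1) (lam R i : ℕ) (s : Config Ω 1) : Prop where
  idx : s.mem 3 = i
  rounds : s.mem 5 = R
  weight : s.mem 6 = (6 / 5) ^ R
  reps : s.mem 7 = lam
  state : ∃ v χ, s.state = QState.flagged v χ ∧ s.mem 16 = bit v
  samples : ∀ j, s.samples j ≤ 1 ∧ (i ≤ j → s.samples j = 0)
  refls : ∀ j, (s.refls j : ℝ) ≤ stageRefls lam R ∧ (i ≤ j → s.refls j = 0)
  steps : (s.steps : ℝ) ≤ s₀.steps + i * stageSteps lam R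

/-- The configurations of stage `i` after the first measurement. -/
structure BeginInv (g u : Ω → ℝ) (i : ℕ) (s t : Config Ω 1) : Prop where
  mem : ∀ a, a ≠ 16 → t.mem a = s.mem a
  state : ∃ v c, t.state = axis g u v c ∧ t.mem 16 = bit v
  samples : t.samples = Function.update s.samples i (s.samples i + 1)
  refls : t.refls = s.refls
  steps : t.steps ≤ s.steps + 9

/-- A stage after its first measurement. -/
def stageTail : Program 1 := block [
  put 9 (const 0), put 10 (const 1), put 11 (cell 6),
  .loop (cell 5) round,
  put 2 (cell 2 * ((const 1 + cosPi (cell 9 / const 2)) / const 2)),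
  put 3 (cell 3 + const 1)]

/-- Cell `16` records the flag left by earlier measurements, so the flag can be set to `1`
deterministically. After `V_i` the state lies in the plane, and measuring the flag puts it on an
axis, where the tests can start. -/
theorem begin_meets [Nonempty Ω] {s : Config Ω 1} {i : ℕ} {θ : ℝ} {g u : Ω → ℝ}
    (hf : G.IsFrame i θ g u) (hi : i < G.len) (h3 : s.mem 3 = i)
    (hs : ∃ v χ, s.state = QState.flagged v χ ∧ s.mem 16 = bit v) :
    ∃ S, stage.run G s.tick = S.bind (fun t => stageTail.run G t) ∧
      Meets S s.prob (BeginInv g u i s) (fun _ => True) 0 := by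
  obtain ⟨v, χ, hst, h16⟩ := hs
  have hamp : ∀ c : ℂ, ∑ σ, ‖G.sampleAmp i σ * c‖ ^ 2 = ‖c‖ ^ 2 := by
    intro c
    have : ∀ σ, ‖G.sampleAmp i σ * c‖ ^ 2 = G.gibbs i σ * ‖c‖ ^ 2 := by
      intro σ
      rw [norm_mul, mul_pow, GibbsSystem.sampleAmp, Complex.norm_real, Real.norm_eq_abs, sq_abs,
        Real.sq_sqrt (G.gibbs_nonneg i σ)]
    simp only [this, ← Finset.sum_mul, G.sum_gibbs, one_mul]
  let S₁ : Multiset (Config Ω 1) := (Finset.univ : Finset Ω).val.map fun τ =>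
    (s.tick.act (QState.replace G i τ)).countSample i
  have hsample : (Program.sample (m := 1) (cell 3)).run G s.tick = S₁ := by
    simp only [Program.run, eval_cell]
    simp [Config.tick, h3, hi, S₁]
  refine ⟨S₁.bind fun t => ((Program.ite (cell 16) .skip
    (block [.had 0, .phase 0 (const 1), .had 0])).run G t).bind fun t =>
      ((Program.rot (cell 3) 0).run G t).bind fun t => (observe 0 16).run G t, ?_, ?_⟩
  · simp only [Multiset.bind_assoc]
    rw [← hsample]
    rfl
  · have h1 : Meets S₁ s.prob (fun t => (∃ c : ℂ, t.state = QState.flagged v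
        fun σ => G.sampleAmp i σ * c) ∧ t.mem = s.mem ∧
        t.samples = Function.update s.samples i (s.samples i + 1) ∧ t.refls = s.refls ∧
        t.steps = s.steps + 2) (fun _ => True) 0 := by
      refine ⟨?_, ?_, by simp [branchProb]⟩
      · intro t ht
        obtain ⟨τ, _, rfl⟩ := Multiset.mem_map.1 ht
        refine ⟨⟨χ τ, ?_⟩, rfl, rfl, rfl, rfl⟩
        change QState.replace G i τ s.state = _
        rw [hst, QState.replace_flagged]
      · rw [branchSum, Multiset.map_map, Config.prob, hst, QState.normSq_flagged]
        refine Finset.sum_congr rfl fun τ _ => ?_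
        change (QState.replace G i τ s.state).normSq = _
        rw [hst, QState.replace_flagged, QState.normSq_flagged, hamp]
    rw [← add_zero (0 : ℝ)]
    refine h1.bind le_rfl fun t ht => ?_
    obtain ⟨⟨c, hc⟩, hmem, hsa, hre, hsteps⟩ := ht
    have hflip : ∃ t', (Program.ite (cell 16) .skip
        (block [.had 0, .phase 0 (const 1), .had 0])).run G t = {t'} ∧
        t'.state = QState.flagged true (fun σ => G.sampleAmp i σ * c) ∧ t'.mem = t.mem ∧
        t'.samples = t.samples ∧ t'.refls = t.refls ∧ t'.steps ≤ t.steps + 5 := by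
      cases v
      · refine ⟨⟨QState.had 0 (QState.phase 0 1 (QState.had 0 t.state)), t.mem, t.samples, t.refls,
          t.steps + 5⟩, ?_, ?_, rfl, rfl, rfl, le_rfl⟩
        · simp [Program.run, hmem, h16, bit, run_block_cons, run_block_nil, Config.tick, Config.act]
        · change QState.had 0 (QState.phase 0 1 (QState.had 0 t.state)) = _
          rw [hc, QState.not_flagged_false]
      · refine ⟨t.tick.tick, ?_, hc, rfl, rfl, rfl, ?_⟩
        · simp [Program.run, hmem, h16, bit]
        · simp [Config.tick]
    obtain ⟨t', hrun', hst', hmem', hsa', hre', hsteps'⟩ := hflip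
    have hrot : (Program.rot (cell 3) 0).run G t' = {t'.act (QState.rot G i 0)} := by
      simp [Program.run, hmem', hmem, h3, hi]
    have hplane : (t'.act (QState.rot G i 0)).state =
        QState.plane g u (c * Real.cos θ) (c * Real.sin θ) := by
      change QState.rot G i 0 t'.state = _
      rw [hst', QState.rot_flagged hf]
    rw [hrun', Multiset.singleton_bind, hrot, Multiset.singleton_bind, run_observe]
    have hp0 : ((t'.act (QState.rot G i 0)).act (QState.project 0 false)).state =
        axis g u false (c * Real.sin θ) := by
      change QState.project 0 false (t'.act (QState.rot G i 0)).state = _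
      rw [hplane, QState.project_false_plane]
      rfl
    have hp1 : ((t'.act (QState.rot G i 0)).act (QState.project 0 true)).state =
        axis g u true (c * Real.cos θ) := by
      change QState.project 0 true (t'.act (QState.rot G i 0)).state = _
      rw [hplane, QState.project_true_plane]
      rfl
    refine ⟨?_, ?_, by simp [branchProb]⟩
    · have hcommon : ∀ b x, BeginInv g u i s
          (((t'.act (QState.rot G i 0)).act (QState.project 0 b)).write 16 x) ↔
          ∃ v c, QState.project 0 b (t'.act (QState.rot G i 0)).state = axis g u v c ∧
            x = bit v := by
        intro b x
        constructor
        · rintro ⟨-, ⟨v, c, h1, h2⟩, -, -, -⟩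
          exact ⟨v, c, h1, by simpa [Config.write] using h2⟩
        · rintro ⟨v, c, h1, h2⟩
          refine ⟨?_, ⟨v, c, h1, by simpa [Config.write] using h2⟩, hsa'.trans hsa, hre'.trans hre,
            ?_⟩
          · intro a ha
            simp [Config.write, Config.act, Config.tick, ha, hmem', hmem]
          · simp only [Config.write, Config.act, Config.tick]
            omega
      intro w hw
      simp only [Multiset.insert_eq_cons, Multiset.mem_cons, Multiset.mem_singleton] at hw
      rcases hw with rfl | rfl
      · exact (hcommon _ _).2 ⟨false, _, hp0, rfl⟩
      · exact (hcommon _ _).2 ⟨true, _, hp1, rfl⟩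
    · rw [branchSum_pair]
      change ((t'.act (QState.rot G i 0)).act (QState.project 0 false)).state.normSq +
        ((t'.act (QState.rot G i 0)).act (QState.project 0 true)).state.normSq = t.state.normSq
      rw [hp0, hp1, normSq_axis hf, normSq_axis hf, hc, QState.normSq_flagged, hamp, norm_mul,
        norm_mul, Complex.norm_real, Complex.norm_real, mul_pow, mul_pow, Real.norm_eq_abs,
        Real.norm_eq_abs, sq_abs, sq_abs, ← mul_add, Real.sin_sq_add_cos_sq, mul_one]

theorem stage_meets [Nonempty Ω] {s₀ s : Config Ω 1} {i lam R : ℕ} {δ : ℝ} (hi : i < G.len)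
    (hE : ∀ σ, 0 ≤ G.energy σ) (hβ : G.β i ≤ G.β (i + 1)) (hα : 1 / 2 ≤ G.ratio i)
    (hlam : 1 ≤ lam) (hlen : G.len ≤ 2 ^ lam) (hδ0 : 0 ≤ δ) (hδ1 : δ ≤ 1)
    (hR : (2 / 3 : ℝ) ^ R ≤ δ / 2) (hs : StageInv s₀ lam R i s) :
    Meets (stage.run G s.tick) s.prob (StageInv s₀ lam R (i + 1))
      (fun t => Approximates G δ i (s.mem 2) → Approximates G δ (i + 1) (t.mem 2))
      (1 / (4 * G.len)) := by
  obtain ⟨τ, hτ0, hτ1, hcos, hτ⟩ := exists_angle hα (G.ratio_le_one hβ hE)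
  obtain ⟨g, u, hf⟩ := G.exists_isFrame hβ hE hcos (by linarith)
  have hw : ∀ σ, G.weight i σ ≤ 1 := fun σ => G.weight_le_one hβ (hE σ)
  obtain ⟨S, hrun, hS⟩ := begin_meets hf hi hs.idx hs.state
  rw [hrun, ← zero_add (1 / (4 * (G.len : ℝ)))]
  refine hS.bind (by positivity) fun t ht => ?_
  obtain ⟨t₁, ht₁⟩ : ∃ t₁ : Config Ω 1,
    t₁ = ((t.tick.write 9 0).tick.write 10 1).tick.write 11 (t.mem 6) := ⟨_, rfl⟩
  have hmem₁ : ∀ j, j ∉ ({9, 10, 11, 16} : Finset ℕ) → t₁.mem j = s.mem j := by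
    intro j hj
    simp only [Finset.mem_insert, Finset.mem_singleton, not_or] at hj
    rw [← ht.mem j hj.2.2.2, ht₁]
    simp [Config.tick, Config.write, hj]
  have hst₁ : t₁.state = t.state := by rw [ht₁]; rfl
  have htail : stageTail.run G t = ((Program.loop (cell 5) round).run G t₁).bind fun w =>
      (block [put 2 (cell 2 * ((const 1 + cosPi (cell 9 / const 2)) / const 2)),
        put 3 (cell 3 + const 1)]).run G w := by
    rw [stageTail, run_block_cons, run_put, Multiset.singleton_bind, run_block_cons, run_put,
      Multiset.singleton_bind, run_block_cons, run_put, Multiset.singleton_bind, run_block_cons,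
      ht₁]
    simp [Config.tick, Config.write]
  have hrounds := rounds_meet (s := t₁) hf hw hi ((hmem₁ 3 (by decide)).trans hs.idx)
    ((hmem₁ 5 (by decide)).trans hs.rounds) ((hmem₁ 7 (by decide)).trans hs.reps) hlam hlen
    (by rw [ht₁]; simp [Config.tick, Config.write]) (by rw [ht₁]; simp [Config.tick, Config.write])
    (by rw [← hs.weight, ← ht.mem 6 (by decide), ht₁]; simp [Config.tick, Config.write])
    (by
      obtain ⟨v, c, h1, h2⟩ := ht.state
      refine ⟨v, c, hst₁.trans h1, ?_⟩
      rw [← h2, ht₁]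
      simp [Config.tick, Config.write]) hτ0 hτ1
  rw [Config.prob, hst₁] at hrounds
  rw [htail, ← add_zero (1 / (4 * (G.len : ℝ)))]
  refine hrounds.bind le_rfl fun w hwi => ?_
  obtain ⟨z, hz⟩ : ∃ z : Config Ω 1, z = ((w.tick.write 2
    (w.mem 2 * ((1 + Real.cos (Real.pi * (w.mem 9 / 2))) / 2))).tick.write 3
      (w.mem 3 + 1)).tick := ⟨_, rfl⟩
  have hrunz : (block [put 2 (cell 2 * ((const 1 + cosPi (cell 9 / const 2)) / const 2)),
        put 3 (cell 3 + const 1)]).run G w = {z} := by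
    rw [hz]
    simp [run_block_cons, run_block_nil, Config.tick, Config.write]
  have hmemw : ∀ j, j < 8 → w.mem j = s.mem j := by
    intro j hj
    exact (hwi.mem j hj).trans (hmem₁ j (by simp; omega))
  have hmemz : ∀ j, j ≠ 2 → j ≠ 3 → z.mem j = w.mem j := by
    intro j h1 h2
    rw [hz]
    simp [Config.tick, Config.write, h1, h2]
  have hstz : z.state = w.state ∧ z.samples = w.samples ∧ z.refls = w.refls ∧
      z.steps = w.steps + 3 := by
    rw [hz]
    exact ⟨rfl, rfl, rfl, rfl⟩
  have ht₁c : t₁.samples = t.samples ∧ t₁.refls = t.refls ∧ t₁.steps = t.steps + 3 := by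
    rw [ht₁]
    exact ⟨rfl, rfl, rfl⟩
  rw [hrunz]
  refine Meets.singleton (by rw [Config.prob, hstz.1]) ?_ ?_
  · refine ⟨?_, ?_, ?_, ?_, ?_, ?_, ?_, ?_⟩
    · rw [hz, Nat.cast_succ, ← hs.idx, ← hmemw 3 (by decide)]
      simp [Config.tick, Config.write]
    · rw [hmemz 5 (by decide) (by decide), hmemw 5 (by decide), hs.rounds]
    · rw [hmemz 6 (by decide) (by decide), hmemw 6 (by decide), hs.weight]
    · rw [hmemz 7 (by decide) (by decide), hmemw 7 (by decide), hs.reps]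
    · obtain ⟨v, c, h1, h2⟩ := hwi.state
      rw [hstz.1, hmemz 16 (by decide) (by decide), h1]
      cases v
      · exact ⟨false, _, QState.plane_false g u c, h2⟩
      · exact ⟨true, _, QState.plane_true g u c, h2⟩
    · intro j
      rw [hstz.2.1, hwi.samples]
      change t₁.samples j ≤ 1 ∧ (i + 1 ≤ j → t₁.samples j = 0)
      rw [ht₁c.1, ht.samples]
      rcases eq_or_ne j i with rfl | hj
      -- Index `i` is touched in stage `i` only, so the counters with index at least `i` are still
      -- zero when the stage begins.
      · rw [Function.update_self, (hs.samples j).2 le_rfl]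
        exact ⟨le_rfl, fun h => by omega⟩
      · rw [Function.update_of_ne hj]
        exact ⟨(hs.samples j).1, fun h => (hs.samples j).2 (by omega)⟩
    · intro j
      rw [hstz.2.2.1]
      rcases eq_or_ne j i with rfl | hj
      · refine ⟨hwi.refls_le.trans ?_, fun h => by omega⟩
        change (t₁.refls j : ℝ) + _ ≤ _
        rw [ht₁c.2.1, ht.refls, (hs.refls j).2 le_rfl, stageRefls]
        have h1 : (6 / 5 : ℝ) ^ R * (5 / 4) ^ R = (3 / 2) ^ R := by
          rw [← mul_pow]
          norm_num
        rw [← h1]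
        have h2 : (0 : ℝ) ≤ lam * (6 / 5) ^ R := by positivity
        push_cast
        linarith
      · rw [hwi.refls j hj]
        change (t₁.refls j : ℝ) ≤ _ ∧ (_ → t₁.refls j = 0)
        rw [ht₁c.2.1, ht.refls]
        exact ⟨(hs.refls j).1, fun h => (hs.refls j).2 (by omega)⟩
    · have h1 := hwi.steps
      have h2 : (z.steps : ℝ) = w.steps + 3 := by
        rw [hstz.2.2.2]
        push_cast
        ring
      have h3 : (t₁.tick.steps : ℝ) ≤ s.steps + 13 := by
        have h4 := ht.steps
        have : t₁.tick.steps ≤ s.steps + 13 := by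
          simp only [Config.tick]
          omega
        exact_mod_cast this
      have h4 := hs.steps
      rw [stageSteps] at h4 ⊢
      push_cast
      linarith
  · intro hτw _ happ
    have hz2 : z.mem 2 = w.mem 2 * ((1 + Real.cos (Real.pi * (w.mem 9 / 2))) / 2) := by
      rw [hz]
      simp [Config.tick, Config.write]
    rw [hz2, hmemw 2 (by decide)]
    refine happ.mul_estimate hδ1 hδ0 hτ hα ?_
    -- The left end of an interval of length `(2/3)^R ≤ δ/2` containing `τ` is used as the estimate.
    rw [hwi.length] at hτw
    rw [abs_le]
    constructor <;> linarith [hτw.1, hτw.2]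

/-! ### Computation of the parameters. -/

theorem repetition_loop_spec {s : Config Ω 1} {l : ℕ} (hl : 1 ≤ l) (h0 : s.mem 0 = l)
    (h7 : s.mem 7 = 1) (h8 : s.mem 8 = 1) :
    ∃ u, (Program.loop (cell 0) (.ite (cell 0 - cell 8)
      (block [put 8 (cell 8 + cell 8), put 7 (cell 7 + const 1)]) .skip)).run G s = {u} ∧
      s.Extends {7, 8} (5 * l + 1) u ∧ ∃ p : ℕ, u.mem 7 = (p + 1 : ℕ) ∧ l ≤ 2 ^ p ∧
        2 ^ p ≤ 2 * l := by
  obtain ⟨u, hu, hext, p, e7, e8, hp, hp'⟩ := run_loop_eq_singleton (G := G) (s := s)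
    (e := cell 0) (n := l)
    (c := .ite (cell 0 - cell 8)
      (block [put 8 (cell 8 + cell 8), put 7 (cell 7 + const 1)]) .skip)
    (I := fun j u => s.Extends {7, 8} (5 * j + 1) u ∧ ∃ p : ℕ, u.mem 7 = (p + 1 : ℕ) ∧
      u.mem 8 = (2 ^ p : ℕ) ∧ (l ≤ 2 ^ p ∨ j ≤ p) ∧ 2 ^ p ≤ 2 * l)
    (by simp [h0]) (by
      refine ⟨⟨rfl, rfl, rfl, fun _ _ => rfl, le_rfl⟩, 0, ?_, ?_, Or.inr le_rfl, ?_⟩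
      · simpa [Config.tick] using h7
      · simpa [Config.tick] using h8
      · omega) (by
      rintro j hj t ⟨hext, p, e7, e8, hp, hp'⟩
      have e0 : t.mem 0 = l := (hext.mem 0 (by decide)).trans h0
      have hst := hext.steps
      by_cases hlt : 2 ^ p < l
      · have hpos : (0 : ℝ) < l - (2 ^ p : ℕ) := by
          rw [sub_pos]
          exact_mod_cast hlt
        refine ⟨(((t.tick.tick.tick.write 8 (t.mem 8 + t.mem 8)).tick.write 7
          (t.mem 7 + 1))).tick, ?_, ⟨hext.state, hext.samples, hext.refls, ?_, ?_⟩, p + 1, ?_, ?_,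
          ?_, ?_⟩
        · simp only [Program.run]
          rw [if_pos]
          · simp [run_block_cons, run_block_nil, Config.tick, Config.write]
          · simp only [eval_sub, eval_cell, Config.tick, e0, e8]
            exact hpos
        · intro a ha
          rw [← hext.mem a ha]
          simp only [Finset.mem_insert, Finset.mem_singleton, not_or] at ha
          simp [Config.tick, Config.write, ha]
        · simp only [Config.tick, Config.write]
          omega
        · simp [Config.tick, Config.write, e7]
        · simp [Config.tick, Config.write, e8, pow_succ]
          ring
        · right
          rcases hp with h | h <;> omega
        · rw [pow_succ]
          omega
      · refine ⟨t.tick.tick.tick, ?_, ⟨hext.state, hext.samples, hext.refls, hext.mem, ?_⟩, p, e7,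
          e8, Or.inl (by omega), hp'⟩
        · simp only [Program.run]
          rw [if_neg]
          rw [eval_sub, eval_cell, eval_cell]
          simp only [Config.tick, e0, e8, sub_pos, not_lt]
          exact_mod_cast not_lt.1 hlt
        · simp only [Config.tick]
          omega)
  refine ⟨u, hu, hext, p, e7, ?_, hp'⟩
  rcases hp with h | h
  · exact h
  · exact h.trans Nat.lt_two_pow_self.le

/-- The machine has no logarithm, so `R` is found by repeated multiplication under a cap of `⌊3/η⌋`
iterations. Stopping at the first length at most `η` keeps the overshoot within a factor `3/2`,
which bounds the reflections. -/
theorem round_count_loop_spec {s : Config Ω 1} {l : ℕ} {ε η : ℝ} (hη : η = ε / (4 * l))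
    (hη0 : 0 < η) (hη1 : η ≤ 1) (h0 : s.mem 0 = l)
    (h1 : s.mem 1 = ε) (h5 : s.mem 5 = 0) (h6 : s.mem 6 = 1) (h10 : s.mem 10 = 1) :
    ∃ u, (Program.loop (const 12 * cell 0 / cell 1)
      (.ite (cell 10 - cell 1 / (const 4 * cell 0))
        (block [put 10 (const (2 / 3) * cell 10), put 6 (const (6 / 5) * cell 6),
          put 5 (cell 5 + const 1)]) .skip)).run G s = {u} ∧
      s.Extends {5, 6, 10} (6 * ⌊3 / η⌋₊ + 1) u ∧ ∃ R : ℕ, u.mem 5 = R ∧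
        u.mem 6 = (6 / 5) ^ R ∧ (2 / 3 : ℝ) ^ R ≤ η ∧ η * (3 / 2) ^ R ≤ 3 / 2 ∧ R ≤ ⌊3 / η⌋₊ := by
  have hl0 : (l : ℝ) ≠ 0 := by
    rintro h
    rw [h] at hη
    norm_num at hη
    exact hη0.ne' hη
  have hε0 : ε ≠ 0 := by
    rintro rfl
    norm_num at hη
    exact hη0.ne' hη
  obtain ⟨u, hu, hext, R, e5, e6, e10, hR, hle, hor⟩ := run_loop_eq_singleton (G := G) (s := s)
    (e := const 12 * cell 0 / cell 1) (n := ⌊3 / η⌋₊)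
    (c := .ite (cell 10 - cell 1 / (const 4 * cell 0))
        (block [put 10 (const (2 / 3) * cell 10), put 6 (const (6 / 5) * cell 6),
          put 5 (cell 5 + const 1)]) .skip)
    (I := fun j u => s.Extends {5, 6, 10} (6 * j + 1) u ∧ ∃ R : ℕ, u.mem 5 = R ∧
      u.mem 6 = (6 / 5) ^ R ∧ u.mem 10 = (2 / 3) ^ R ∧ η * (3 / 2) ^ R ≤ 3 / 2 ∧ R ≤ j ∧
        ((2 / 3 : ℝ) ^ R ≤ η ∨ R = j))
    (by
      congr 1
      simp only [eval_div, eval_mul, eval_const, eval_cell, h0, h1, hη]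
      push_cast
      field_simp
      norm_num) (by
      refine ⟨⟨rfl, rfl, rfl, fun _ _ => rfl, le_rfl⟩, 0, ?_, ?_, ?_, ?_, le_rfl, Or.inr rfl⟩
      · simpa [Config.tick] using h5
      · simpa [Config.tick] using h6
      · simpa [Config.tick] using h10
      · linarith) (by
      rintro j hj t ⟨hext, R, e5, e6, e10, hR, hle, hor⟩
      have e0 : t.mem 0 = l := (hext.mem 0 (by decide)).trans h0
      have e1 : t.mem 1 = ε := (hext.mem 1 (by decide)).trans h1
      have hst := hext.steps
      have htest : (cell 10 - cell 1 / (const 4 * cell 0)).eval t.tick.mem = (2 / 3) ^ R - η := by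
        simp only [eval_sub, eval_div, eval_mul, eval_const, eval_cell, Config.tick, e0, e1, e10,
          hη]
        norm_num
      by_cases hlt : η < (2 / 3) ^ R
      · have hRj : R = j := hor.resolve_left (not_le.2 hlt)
        refine ⟨(((t.tick.tick.tick.write 10 (2 / 3 * t.mem 10)).tick.write 6
          (6 / 5 * t.mem 6)).tick.write 5 (t.mem 5 + 1)).tick, ?_,
          ⟨hext.state, hext.samples, hext.refls, ?_, ?_⟩, R + 1, ?_, ?_, ?_, ?_, by omega,
          Or.inr (by omega)⟩
        · simp only [Program.run]
          rw [htest, if_pos (sub_pos.2 hlt)]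
          simp [run_block_cons, run_block_nil, Config.tick, Config.write]
        · intro a ha
          rw [← hext.mem a ha]
          simp only [Finset.mem_insert, Finset.mem_singleton, not_or] at ha
          simp [Config.tick, Config.write, ha]
        · simp only [Config.tick, Config.write]
          omega
        · simp [Config.tick, Config.write, e5]
        · simp [Config.tick, Config.write, e6, pow_succ]
          ring
        · simp [Config.tick, Config.write, e10, pow_succ]
          ring
        · have h3 : (2 / 3 : ℝ) ^ R * (3 / 2) ^ R = 1 := by
            rw [← mul_pow]
            norm_num
          have h4 : η * (3 / 2) ^ R ≤ (2 / 3 : ℝ) ^ R * (3 / 2) ^ R := by gcongr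
          rw [pow_succ]
          linarith
      · refine ⟨t.tick.tick.tick, ?_, ⟨hext.state, hext.samples, hext.refls, hext.mem, ?_⟩, R, e5,
          e6, e10, hR, by omega, Or.inl (not_lt.1 hlt)⟩
        · simp only [Program.run]
          rw [htest, if_neg (by rwa [sub_pos])]
        · simp only [Config.tick]
          omega)
  refine ⟨u, hu, hext, R, e5, e6, ?_, hR, hle⟩
  rcases hor with h | h
  · exact h
  -- Even if the cap is reached the length is small enough: Bernoulli gives `(3/2)^R ≥ 1 + R/2`, and
  -- `R + 1 > 3/η`.
  · have h1 : 3 / η < R + 1 := by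
      rw [h]
      exact Nat.lt_floor_add_one _
    have h2 : 1 + (R : ℝ) * (1 / 2) ≤ (3 / 2 : ℝ) ^ R := by
      have := one_add_mul_le_pow (a := (1 / 2 : ℝ)) (by norm_num) R
      norm_num at this ⊢
      linarith
    have h3 : (2 / 3 : ℝ) ^ R * (3 / 2) ^ R = 1 := by
      rw [← mul_pow]
      norm_num
    have h4 : 1 ≤ η * (3 / 2) ^ R := by
      rw [div_lt_iff₀ hη0] at h1
      nlinarith
    have h5 : (0 : ℝ) < (2 / 3) ^ R := by positivity
    nlinarith

theorem setup_spec {s : Config Ω 1} {l : ℕ} {ε : ℝ} (hl : 1 ≤ l) (hε0 : 0 < ε) (hε1 : ε ≤ 1)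
    (h0 : s.mem 0 = l) (h1 : s.mem 1 = ε) (h5 : s.mem 5 = 0) :
    ∃ u, setup.run G s = {u} ∧ s.Extends {5, 6, 7, 8, 10} (5 * l + 6 * ⌊12 * (l / ε)⌋₊ + 7) u ∧
      ∃ p R : ℕ, u.mem 7 = (p + 1 : ℕ) ∧ l ≤ 2 ^ p ∧ 2 ^ p ≤ 2 * l ∧ u.mem 5 = R ∧
        u.mem 6 = (6 / 5) ^ R ∧ (2 / 3 : ℝ) ^ R ≤ ε / (4 * l) ∧ (3 / 2 : ℝ) ^ R ≤ 6 * (l / ε) ∧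
        R ≤ ⌊12 * (l / ε)⌋₊ := by
  have hl1 : (1 : ℝ) ≤ l := by exact_mod_cast hl
  obtain ⟨u₁, hu₁, hext₁, p, hp7, hp, hp'⟩ := repetition_loop_spec (G := G)
    (s := (s.tick.write 7 1).tick.write 8 1) hl (by simpa [Config.tick, Config.write] using h0)
    (by simp [Config.tick, Config.write]) (by simp [Config.tick, Config.write])
  have hmem₁ : ∀ j, j ∉ ({7, 8} : Finset ℕ) → u₁.mem j = s.mem j := by
    intro j hj
    rw [hext₁.mem j hj]
    simp only [Finset.mem_insert, Finset.mem_singleton, not_or] at hj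
    simp [Config.tick, Config.write, hj]
  have hη0 : 0 < ε / (4 * l) := by positivity
  have hη1 : ε / (4 * l) ≤ 1 := by
    rw [div_le_one (by positivity)]
    linarith
  have hη : 3 / (ε / (4 * l)) = 12 * (l / ε) := by
    field_simp
    norm_num
  obtain ⟨u₂, hu₂, hext₂, R, hR5, hR6, hR, hR', hRle⟩ := round_count_loop_spec (G := G)
    (s := (u₁.tick.write 6 1).tick.write 10 1) rfl hη0 hη1
    (by simpa [Config.tick, Config.write, hmem₁] using h0)
    (by simpa [Config.tick, Config.write, hmem₁] using h1)
    (by simpa [Config.tick, Config.write, hmem₁] using h5)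
    (by simp [Config.tick, Config.write]) (by simp [Config.tick, Config.write])
  rw [hη] at hext₂ hRle
  refine ⟨u₂.tick, ?_, ⟨?_, ?_, ?_, ?_, ?_⟩, p, R, ?_, hp, hp', hR5, hR6, hR, ?_, hRle⟩
  · rw [setup, run_block_cons, run_put, Multiset.singleton_bind, run_block_cons, run_put,
      Multiset.singleton_bind, run_block_cons]
    simp only [eval_const, Rat.cast_one]
    rw [hu₁, Multiset.singleton_bind, run_block_cons, run_put, Multiset.singleton_bind,
      run_block_cons, run_put, Multiset.singleton_bind, run_block_cons]
    simp only [eval_const, Rat.cast_one]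
    rw [hu₂, Multiset.singleton_bind, run_block_nil]
  · exact hext₂.state.trans hext₁.state
  · exact hext₂.samples.trans hext₁.samples
  · exact hext₂.refls.trans hext₁.refls
  · intro j hj
    simp only [Finset.mem_insert, Finset.mem_singleton, not_or] at hj
    rw [← hmem₁ j (by simp [hj])]
    refine (hext₂.mem j (by simp [hj])).trans ?_
    simp [Config.tick, Config.write, hj]
  · have a1 : u₂.steps ≤ u₁.steps + 1 + 1 + (6 * ⌊12 * (l / ε)⌋₊ + 1) := hext₂.steps
    have a2 : u₁.steps ≤ s.steps + 1 + 1 + (5 * l + 1) := hext₁.steps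
    simp only [Config.tick]
    omega
  · rw [← hp7]
    refine (hext₂.mem 7 (by decide)).trans ?_
    simp [Config.tick, Config.write]
  · rw [div_mul_eq_mul_div, div_le_iff₀ (by positivity)] at hR'
    rw [← mul_div_assoc, le_div_iff₀ hε0]
    linarith

/-! ### Assembly of the stages and the final bounds. -/

theorem scheme_meets [Nonempty Ω] {ε : ℝ} {φ : Ω → ℂ} (hl : 1 ≤ G.len)
    (hE : ∀ σ, 0 ≤ G.energy σ) (hβ0 : G.β 0 = 0) (hβ : ∀ i < G.len, G.β i ≤ G.β (i + 1))
    (hα : ∀ i < G.len, 1 / 2 ≤ G.ratio i) (hε0 : 0 < ε) (hε1 : ε ≤ 1) :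
    ∃ p R : ℕ, 2 ^ p ≤ 2 * G.len ∧ (3 / 2 : ℝ) ^ R ≤ 6 * (G.len / ε) ∧
      R ≤ ⌊12 * (G.len / ε)⌋₊ ∧
      Meets (scheme.run G (Config.start 1 G ε φ)) (∑ σ, ‖φ σ‖ ^ 2)
        (fun t => ∀ j, t.samples j ≤ 1 ∧ (t.refls j : ℝ) ≤ stageRefls (p + 1) R ∧
          (t.steps : ℝ) ≤ 5 * G.len + 6 * ⌊12 * (G.len / ε)⌋₊ + 10 +
            G.len * stageSteps (p + 1) R)
        (fun t => Approximates G (ε / (2 * G.len)) G.len t.output) (1 / 4) := by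
  set s : Config Ω 1 := Config.start 1 G ε φ with hs
  have hl1 : (1 : ℝ) ≤ G.len := by exact_mod_cast hl
  obtain ⟨u, hu, hext, p, R, h7, hp, hp', h5, h6, hR, hR', hRle⟩ := setup_spec (G := G) (s := s)
    hl hε0 hε1 (by simp [hs, Config.start]) (by simp [hs, Config.start])
    (by simp [hs, Config.start])
  refine ⟨p, R, hp', hR', hRle, ?_⟩
  have hstages := Meets.loop (G := G) (s := u) (e := cell 0) (c := stage) (n := G.len)
    (I := StageInv u.tick (p + 1) R)
    (Q := fun i t => Approximates G (ε / (2 * G.len)) i (t.mem 2))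
    (δ := fun _ => 1 / (4 * G.len)) (fun _ => by positivity)
    (by rw [eval_cell, hext.mem 0 (by decide)]; simp [hs, Config.start])
    (by
      -- The zero initially in cell `16` correctly records the flag `|0⟩`, and the arbitrary `φ` is
      -- the register part of the product state.
      refine ⟨?_, h5, h6, h7, ⟨false, φ, ?_, ?_⟩, ?_, ?_, ?_⟩
      · change u.mem 3 = _
        rw [hext.mem 3 (by decide)]
        simp [hs, Config.start]
      · change u.state = _
        rw [hext.state]
        exact QState.init_eq_flagged φ
      · change u.mem 16 = _
        rw [hext.mem 16 (by decide)]
        simp [hs, Config.start, bit]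
      · intro j
        change u.samples j ≤ 1 ∧ (_ → u.samples j = 0)
        rw [hext.samples]
        simp [hs, Config.start]
      · intro j
        change (u.refls j : ℝ) ≤ _ ∧ (_ → u.refls j = 0)
        rw [hext.refls]
        simp only [hs, Config.start, Nat.cast_zero, implies_true, and_true, stageRefls]
        positivity
      · simp)
    (by
      -- The running product starts from the input `|Ω|`, which is exactly `Z_0`.
      have hZ : G.Z 0 = Fintype.card Ω := by simp [GibbsSystem.Z, hβ0]
      change Approximates G _ 0 (u.mem 2)
      rw [hext.mem 2 (by decide)]
      simp [hs, Config.start, Approximates, hZ])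
    (fun i hi t ht => stage_meets hi hE (hβ i hi) (hα i hi) (by omega)
      (hp.trans (Nat.pow_le_pow_right (by norm_num) (by omega))) (by positivity)
      (by rw [div_le_one (by positivity)]; linarith)
      (hR.trans (le_of_eq (by field_simp; norm_num))) ht)
  have hprob : u.prob = ∑ σ, ‖φ σ‖ ^ 2 := by
    rw [Config.prob, hext.state, ← QState.normSq_flagged false φ, ← QState.init_eq_flagged]
    rfl
  have hsum : ∑ _j ∈ Finset.range G.len, 1 / (4 * (G.len : ℝ)) = 1 / 4 := by
    rw [Finset.sum_const, Finset.card_range, nsmul_eq_mul]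
    field_simp
  rw [hprob, hsum] at hstages
  rw [scheme, run_block_cons, hu, Multiset.singleton_bind, run_block_cons,
    ← add_zero (1 / 4 : ℝ)]
  refine hstages.bind le_rfl fun t ht => ?_
  rw [run_block_cons, run_put, Multiset.singleton_bind, run_block_nil]
  refine Meets.singleton rfl (fun j => ⟨(ht.samples j).1, (ht.refls j).1, ?_⟩) fun h => ?_
  · have h1 := ht.steps
    have h2 : (u.tick.steps : ℝ) ≤ 5 * G.len + 6 * ⌊12 * (G.len / ε)⌋₊ + 8 := by
      have h3 : u.steps ≤ 0 + _ := hext.steps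
      have h4 : u.tick.steps ≤ 5 * G.len + 6 * ⌊12 * (G.len / ε)⌋₊ + 8 := by
        simp only [Config.tick]
        omega
      exact_mod_cast h4
    simp only [Config.tick, Config.write]
    push_cast
    linarith
  · simpa [Config.output, Config.tick, Config.write] using h

theorem one_add_div_pow_le {ε : ℝ} (hε0 : 0 ≤ ε) (hε1 : ε ≤ 1) {l : ℕ} (hl : 1 ≤ l) :
    (1 + ε / (2 * l)) ^ l ≤ 1 + ε ∧ 1 - ε ≤ (1 - ε / (2 * l)) ^ l := by
  have hl1 : (1 : ℝ) ≤ l := by exact_mod_cast hl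
  have hmul : (l : ℝ) * (ε / (2 * l)) = ε / 2 := by field_simp
  constructor
  · calc (1 + ε / (2 * l)) ^ l ≤ Real.exp (ε / (2 * l)) ^ l := by
          gcongr
          linarith [Real.add_one_le_exp (ε / (2 * l))]
      _ = Real.exp (ε / 2) := by rw [← Real.exp_nat_mul, hmul]
      _ ≤ 1 + ε := by
          have h := (abs_le.1 (Real.abs_exp_sub_one_sub_id_le (x := ε / 2)
            (by rw [abs_of_nonneg (by linarith)]; linarith))).2
          nlinarith
  · have hδ : ε / (2 * l) ≤ 1 := by
      rw [div_le_one (by positivity)]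
      linarith
    have := one_add_mul_le_pow (a := -(ε / (2 * l))) (by linarith) l
    rw [mul_neg, hmul, ← sub_eq_add_neg, ← sub_eq_add_neg] at this
    linarith

theorem repetitions_le {p l : ℕ} (hl : 1 ≤ l) (hp : 2 ^ p ≤ 2 * l) :
    ((p + 1 : ℕ) : ℝ) ≤ 6 * Real.log (l + 1) := by
  have hl1 : (1 : ℝ) ≤ l := by exact_mod_cast hl
  have h2 : (2 : ℝ) ^ p ≤ 2 * l := by exact_mod_cast hp
  have h3 := Real.log_le_log (by positivity) h2
  rw [Real.log_pow, Real.log_mul (by norm_num) (by positivity)] at h3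
  have h4 : Real.log l ≤ Real.log (l + 1) := Real.log_le_log (by positivity) (by linarith)
  have h5 : Real.log 2 ≤ Real.log (l + 1) := Real.log_le_log (by norm_num) (by linarith)
  have h6 := Real.log_two_gt_d9
  push_cast
  nlinarith [Nat.cast_nonneg (α := ℝ) p]

end

end QScheme

theorem mainTheorem2 :
    ∃ (m : ℕ) (A : QScheme.Program m) (C : ℝ) (d : ℕ),
      ∀ (Ω : Type*) [Fintype Ω] (G : QScheme.GibbsSystem Ω) (ε : ℝ) (φ : Ω → ℂ),
        1 ≤ G.len →
        (∀ σ, 0 ≤ G.energy σ) →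
        G.β 0 = 0 →
        (∀ i < G.len, G.β i ≤ G.β (i + 1)) →
        (∀ i < G.len, 1 / 2 ≤ G.ratio i) →
        0 < ε → ε ≤ 1 →
        ∑ σ, ‖φ σ‖ ^ 2 = 1 →
        3 / 4 ≤ QScheme.branchProb (A.run G (QScheme.Config.start m G ε φ))
            (fun s => (1 - ε) * G.Z G.len ≤ s.output ∧ s.output ≤ (1 + ε) * G.Z G.len) ∧
        ∀ s ∈ A.run G (QScheme.Config.start m G ε φ),
          (∀ i < G.len,
            (s.samples i : ℝ) ≤ C * Real.log ((G.len : ℝ) + 1) ∧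
            (s.refls i : ℝ) ≤ C * ((G.len : ℝ) / ε * Real.log ((G.len : ℝ) + 1))) ∧
          (s.steps : ℝ) ≤ C * ((G.len : ℝ) / ε) ^ d := by
  -- With `x = ℓ/ε`, a round takes `O(x³)` steps and there are `O(x)` rounds in each of at most `x`
  -- stages, whence the exponent `5`. The constant is dictated by the leading term `2592 * 10^13 *
  -- x^5`.
  refine ⟨1, QScheme.scheme, 10 ^ 17, 5, ?_⟩
  intro Ω _ G ε φ hl hE hβ0 hβ hα hε0 hε1 hφ
  -- An empty state space admits no normalised initial state.
  have hne : Nonempty Ω := by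
    by_contra h
    rw [not_nonempty_iff] at h
    simp at hφ
  obtain ⟨p, R, hp, hR, hRle, hmeets⟩ := QScheme.scheme_meets (φ := φ) hl hE hβ0 hβ hα hε0 hε1
  rw [hφ] at hmeets
  have hl1 : (1 : ℝ) ≤ G.len := by exact_mod_cast hl
  constructor
  · rw [QScheme.branchProb_not, hmeets.mass]
    have hfail := hmeets.fail
    have hle : QScheme.branchProb (QScheme.scheme.run G (QScheme.Config.start 1 G ε φ))
        (fun s => ¬ ((1 - ε) * G.Z G.len ≤ s.output ∧ s.output ≤ (1 + ε) * G.Z G.len)) ≤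
        QScheme.branchProb (QScheme.scheme.run G (QScheme.Config.start 1 G ε φ))
          (fun s => ¬ QScheme.Approximates G (ε / (2 * G.len)) G.len s.output) := by
      refine QScheme.branchProb_mono fun s _ h hs => h ?_
      have hZ := (G.Z_pos G.len).le
      obtain ⟨b1, b2⟩ := QScheme.one_add_div_pow_le hε0.le hε1 hl
      have c1 := mul_le_mul_of_nonneg_left b1 hZ
      have c2 := mul_le_mul_of_nonneg_left b2 hZ
      exact ⟨by linarith [hs.1], by linarith [hs.2]⟩
    linarith
  · intro s hs
    have hsure := hmeets.sure s hs
    have hlog : 1 / 2 ≤ Real.log ((G.len : ℝ) + 1) := by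
      have h5 : Real.log 2 ≤ Real.log ((G.len : ℝ) + 1) :=
        Real.log_le_log (by norm_num) (by linarith)
      linarith [Real.log_two_gt_d9]
    have hlam := QScheme.repetitions_le hl hp
    have hx1 : (G.len : ℝ) ≤ G.len / ε := by
      rw [le_div_iff₀ hε0]
      nlinarith
    have hRx : (R : ℝ) ≤ 12 * (G.len / ε) :=
      (Nat.cast_le.2 hRle).trans (Nat.floor_le (by positivity))
    have hfl : (⌊12 * ((G.len : ℝ) / ε)⌋₊ : ℝ) ≤ 12 * (G.len / ε) := Nat.floor_le (by positivity)
    have hloglen : Real.log ((G.len : ℝ) + 1) ≤ G.len := by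
      linarith [Real.log_le_sub_one_of_pos (show (0 : ℝ) < G.len + 1 by positivity)]
    generalize hx : (G.len : ℝ) / ε = x at *
    generalize Real.log ((G.len : ℝ) + 1) = y at *
    have hx1' : 1 ≤ x := hl1.trans hx1
    refine ⟨fun i _ => ⟨?_, ?_⟩, ?_⟩
    · have : (s.samples i : ℝ) ≤ 1 := by exact_mod_cast (hsure i).1
      linarith
    · refine (hsure i).2.1.trans ?_
      rw [QScheme.stageRefls]
      calc 24 * 10 ^ 10 * ((p + 1 : ℕ) : ℝ) * (3 / 2) ^ R
          ≤ 24 * 10 ^ 10 * (6 * y) * (6 * x) := by gcongr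
        _ = 864 * 10 ^ 10 * (x * y) := by ring
        _ ≤ 10 ^ 17 * (x * y) := by
            gcongr
            norm_num
    · refine (hsure 0).2.2.trans ?_
      have hlam' : ((p + 1 : ℕ) : ℝ) ≤ 6 * x := by linarith
      have hround : QScheme.roundSteps (p + 1) R ≤ 216 * 10 ^ 13 * x ^ 3 := by
        rw [QScheme.roundSteps]
        calc 10 ^ 13 * ((p + 1 : ℕ) : ℝ) * ((3 / 2) ^ R) ^ 2
            ≤ 10 ^ 13 * (6 * x) * (6 * x) ^ 2 := by gcongr
          _ = 216 * 10 ^ 13 * x ^ 3 := by ring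
      have hround0 : 0 ≤ QScheme.roundSteps (p + 1) R := by
        rw [QScheme.roundSteps]
        positivity
      have hstage : QScheme.stageSteps (p + 1) R ≤ 30 + 12 * x * (216 * 10 ^ 13 * x ^ 3) := by
        rw [QScheme.stageSteps]
        gcongr
      have hstage0 : 0 ≤ QScheme.stageSteps (p + 1) R := by
        rw [QScheme.stageSteps]
        positivity
      have h1 : (G.len : ℝ) * QScheme.stageSteps (p + 1) R ≤
          x * (30 + 12 * x * (216 * 10 ^ 13 * x ^ 3)) := by gcongr
      have h2 : x ≤ x ^ 5 := le_self_pow₀ hx1' (by norm_num)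
      have h3 : x * (30 + 12 * x * (216 * 10 ^ 13 * x ^ 3)) =
          30 * x + 2592 * 10 ^ 13 * x ^ 5 := by ring
      rw [h3] at h1
      linarith
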